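/- Let $p$ be a prime, let $F$ be a field of characteristic $p$ with separable closure $F^{\mathrm{sep}}$ and absolute Galois group $\Gamma_F=\mathrm{Gal}(F^{\mathrm{sep}}|F)$, and let $F^{\mathrm{perf}}$ and $F^{\mathrm{alg}}=(F^{\mathrm{sep}})^{\mathrm{perf}}$ be the perfect closures of $F$ and $F^{\mathrm{sep}}$. The group $\Gamma_F$ acts on $F^{\mathrm{alg}}$ by functoriality of the perfect closure. Let $W$ denote the ring of $p$-typical Witt vectors. Let $\mathfrak g$ be a finite Lie $\mathbb Z_p$-algebra of nilpotency class $<p$. For every perfect field $R$ of characteristic $p$, equip $\mathfrak g\otimes W(R)=\mathfrak g\otimes_{\mathbb Z_p}W(R)$ with the $W(R)$-linear extension of the Lie bracket and with the endomorphism $\sigma$ induced by the Frobenius $x\mapsto x^p$ of $R$. Let $\circ$ be the truncated Baker--Campbell--Hausdorff law $x\circ y=x+y+\frac12[x,y]+\cdots$, i.e. the sum of the terms of degree $<p$ of the Baker--Campbell--Hausdorff series. Then $\circ$ is a group law, with neutral element $0$ and inverse $x\mapsto -x$, on $\mathfrak g$, on $\mathfrak g\otimes W(F^{\mathrm{perf}})$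 and on $\mathfrak g\otimes W(F^{\mathrm{alg}})$. Let $G=(\mathfrak g,\circ)$, with the discrete topology and the trivial action of $\Gamma_F$, so that $H^1(\Gamma_F,G)$ is the set of $G$-conjugacy classes of continuous homomorphisms $\Gamma_F\to G$. Let the group $(\mathfrak g\otimes W(F^{\mathrm{perf}}),\circ)$ act on the set $\mathfrak g\otimes W(F^{\mathrm{perf}})$ by $g.m=\sigma(g)\circ m\circ(-g)$, and for $g\in\mathfrak g\otimes W(F^{\mathrm{alg}})$ write $\boldsymbol\wp(g)=\sigma(g)\circ(-g)$. Identify elements of $\mathfrak g$ and of $\mathfrak g\otimes W(F^{\mathrm{perf}})$ with their images in $\mathfrak g\otimes W(F^{\mathrm{alg}})$. There is a bijection $$\mathrm{orb}:H^1(\Gamma_F,G)\longrightarrow\{\text{orbits of }(\mathfrak g\otimes W(F^{\mathrm{perf}}),\circ)\text{ on }\mathfrak g\otimes W(F^{\mathrm{perf}})\},\qquad [\tau\mapsto(-g)\circ\tau(g)]\longmapsto[\boldsymbol\wp(g)],$$ for any $g\in\mathfrak g\otimes W(F^{\mathrm{alg}})$ such that $\boldsymbol\wp(g)\in\mathfrak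 g\otimes W(F^{\mathrm{perf}})$. That is: for each such $g$, the map $\tau\mapsto(-g)\circ\tau(g)$ is a continuous homomorphism $\Gamma_F\to G$; every continuous homomorphism $\Gamma_F\to G$ is of this form; and $\mathrm{orb}$ is given by the formula above. Moreover, if $\mathrm{orb}([\gamma])=[m]$, then there is a group isomorphism $$\mathrm{Stab}_G(\gamma)\simeq\mathrm{Stab}_{(\mathfrak g\otimes W(F^{\mathrm{perf}}),\circ)}(m),$$ where $G$ acts on continuous homomorphisms $\Gamma_F\to G$ by conjugation. -/

import Mathlib

open scoped TensorProduct

noncomputable section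

/-! ### The truncated Baker-Campbell-Hausdorff law -/

/-- The left-normed iterated bracket `[x₁, x₂, …, xₙ] = [[…[[x₁, x₂], x₃], …], xₙ]`. -/
def leftBracket {L : Type*} [LieRing L] : List L → L
  | [] => 0
  | a :: l => l.foldl (fun u v => ⁅u, v⁆) a

/-- The word `x^{r₁} y^{s₁} ⋯ x^{rₘ} y^{sₘ}`, as a list of letters. -/
def dynkinWord {L : Type*} (x y : L) {m n : ℕ} (e : Fin m → Fin n × Fin n) : List L :=
  (List.ofFn fun i =>
    List.replicate ((e i).1 : ℕ) x ++ List.replicate ((e i).2 : ℕ) y).flatten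

/-- The homogeneous part of degree `n` of the Baker-Campbell-Hausdorff series
`log (exp x * exp y)`, in the form of Dynkin:
`∑ (-1)^(m-1) / (n m ∏ rᵢ! sᵢ!) [x^{r₁} y^{s₁} ⋯ x^{rₘ} y^{sₘ}]`, the sum being over all `m` and
all `(rᵢ, sᵢ)` with `rᵢ + sᵢ > 0` and `∑ (rᵢ + sᵢ) = n`.  For `n < p` all the denominators are
prime to `p`, so that they are units of `ℤ_[p]` and `Ring.inverse` is the true inverse. -/
def bchTerm (p : ℕ) [Fact p.Prime] {L : Type*} [LieRing L] [LieAlgebra ℤ_[p] L]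
    (n : ℕ) (x y : L) : L :=
  ∑ m ∈ Finset.Icc 1 n,
    ∑ e : Fin m → Fin (n + 1) × Fin (n + 1) with
      (∀ i, 0 < ((e i).1 : ℕ) + ((e i).2 : ℕ)) ∧ ∑ i, (((e i).1 : ℕ) + ((e i).2 : ℕ)) = n,
      ((-1 : ℤ_[p]) ^ (m - 1) *
        Ring.inverse
          ((n * m * ∏ i, Nat.factorial (e i).1 * Nat.factorial (e i).2 : ℕ) : ℤ_[p])) •
        leftBracket (dynkinWord x y e)

/-- The truncated Baker-Campbell-Hausdorff law `x ∘ y`: the sum of the terms of the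
Baker-Campbell-Hausdorff formula that do not feature `p`-fold commutators. -/
def bch (p : ℕ) [Fact p.Prime] {L : Type*} [LieRing L] [LieAlgebra ℤ_[p] L] (x y : L) : L :=
  ∑ n ∈ Finset.Icc 1 (p - 1), bchTerm p n x y

/-- The operation `∘` is a group law on `L`, with neutral element `0` and inverse `x ↦ -x`. -/
structure IsBCHGroupLaw (p : ℕ) [Fact p.Prime] (L : Type*) [LieRing L] [LieAlgebra ℤ_[p] L] :
    Prop where
  assoc : ∀ x y z : L, bch p (bch p x y) z = bch p x (bch p y z)
  zero_bch : ∀ x : L, bch p 0 x = x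
  bch_zero : ∀ x : L, bch p x 0 = x
  neg_bch : ∀ x : L, bch p (-x) x = 0

/-- The group `(L, ∘)`. -/
def BCHGroup {p : ℕ} [Fact p.Prime] {L : Type*} [LieRing L] [LieAlgebra ℤ_[p] L]
    (_h : IsBCHGroupLaw p L) : Type _ := L

namespace BCHGroup

variable {p : ℕ} [Fact p.Prime] {L : Type*} [LieRing L] [LieAlgebra ℤ_[p] L]
  {h : IsBCHGroupLaw p L}

/-- The identity map from the group `(L, ∘)` to `L`. -/
def val (x : BCHGroup h) : L := x

/-- The identity map from `L` to the group `(L, ∘)`. -/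
def mk (h : IsBCHGroupLaw p L) (x : L) : BCHGroup h := x

instance : Group (BCHGroup h) where
  mul x y := mk h (bch p x.val y.val)
  one := mk h 0
  inv x := mk h (-x.val)
  mul_assoc x y z := h.assoc x y z
  one_mul x := h.zero_bch x
  mul_one x := h.bch_zero x
  inv_mul_cancel x := h.neg_bch x

/-- The group `(L, ∘)` carries the discrete topology. -/
instance : TopologicalSpace (BCHGroup h) := ⊥

instance : DiscreteTopology (BCHGroup h) := ⟨rfl⟩

end BCHGroup

section Naturality

variable {p : ℕ} [Fact p.Prime] {L L' : Type*} [LieRing L] [LieAlgebra ℤ_[p] L]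
  [LieRing L'] [LieAlgebra ℤ_[p] L'] (f : L →ₗ⁅ℤ_[p]⁆ L')

theorem map_leftBracket (l : List L) : f (leftBracket l) = leftBracket (l.map f) := by
  cases l with
  | nil => simp [leftBracket]
  | cons a l =>
    simp only [leftBracket, List.map_cons]
    induction l generalizing a with
    | nil => simp
    | cons b l ih => simp [ih]

theorem map_dynkinWord (x y : L) {m n : ℕ} (e : Fin m → Fin n × Fin n) :
    (dynkinWord x y e).map f = dynkinWord (f x) (f y) e := by
  simp [dynkinWord, List.map_flatten, List.map_ofFn, Function.comp_def]

theorem map_bch (x y : L) : f (bch p x y) = bch p (f x) (f y) := by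
  simp only [bch, bchTerm, map_sum, map_smul, map_leftBracket, map_dynkinWord]

end Naturality

/-! ### Perfect closures and Witt vectors -/

section Witt

variable (p : ℕ) [Fact p.Prime]

/-- Functoriality of the perfect closure. -/
def perfMap {K K' : Type*} [CommRing K] [CharP K p] [CommRing K'] [CharP K' p] (f : K →+* K') :
    PerfectClosure K p →+* PerfectClosure K' p :=
  PerfectClosure.lift K p (PerfectClosure K' p) ((PerfectClosure.of K' p).comp f)

/-- The `ℤ_[p]`-algebra structure of `W(R)`, for `R` of characteristic `p`:
it is given by `ℤ_[p] = W(𝔽_p) → W(R)`. -/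
instance wittAlgebra (R : Type*) [CommRing R] [CharP R p] : Algebra ℤ_[p] (WittVector p R) :=
  ((WittVector.map (ZMod.castHom (dvd_refl p) R)).comp (WittVector.fromPadicInt p)).toAlgebra

/-- Functoriality of the `ℤ_[p]`-algebra `W(R)`: a ring homomorphism acts coordinatewise. -/
def wittMap {R S : Type*} [CommRing R] [CharP R p] [CommRing S] [CharP S p] (f : R →+* S) :
    WittVector p R →ₐ[ℤ_[p]] WittVector p S where
  __ := WittVector.map f
  commutes' a := by
    have h : f.comp (ZMod.castHom (dvd_refl p) R) = ZMod.castHom (dvd_refl p) S :=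
      RingHom.ext_zmod _ _
    change WittVector.map f (WittVector.map (ZMod.castHom (dvd_refl p) R)
      (WittVector.fromPadicInt p a)) =
      WittVector.map (ZMod.castHom (dvd_refl p) S) (WittVector.fromPadicInt p a)
    rw [← h]
    ext n
    simp [WittVector.map_coeff]

variable (𝔤 : Type*) [LieRing 𝔤] [LieAlgebra ℤ_[p] 𝔤]

/-- The Lie `ℤ_[p]`-algebra `𝔤 ⊗ W(R)`, the bracket being extended `W(R)`-linearly
(the factor `W(R)` is written on the left). -/
abbrev LieWitt (R : Type*) [CommRing R] [CharP R p] : Type _ := WittVector p R ⊗[ℤ_[p]] 𝔤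

/-- The map `𝔤 ⊗ W(R) → 𝔤 ⊗ W(S)` induced by a ring homomorphism `R → S`. -/
def lieWittMap {R S : Type*} [CommRing R] [CharP R p] [CommRing S] [CharP S p] (f : R →+* S) :
    LieWitt p 𝔤 R →ₗ⁅ℤ_[p]⁆ LieWitt p 𝔤 S :=
  LieAlgebra.ExtendScalars.map (wittMap p f) LieHom.id

/-- The map `σ` of `𝔤 ⊗ W(R)` induced by the absolute Frobenius `x ↦ x ^ p` of `R`. -/
def lieWittFrob (R : Type*) [CommRing R] [CharP R p] : LieWitt p 𝔤 R →ₗ⁅ℤ_[p]⁆ LieWitt p 𝔤 R :=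
  lieWittMap p 𝔤 (frobenius R p)

/-- The canonical map `𝔤 → 𝔤 ⊗ W(R)`. -/
def lieWittIncl (R : Type*) [CommRing R] [CharP R p] (x : 𝔤) : LieWitt p 𝔤 R :=
  (1 : WittVector p R) ⊗ₜ[ℤ_[p]] x

/-- The multiplicative Artin-Schreier map `g ↦ σ(g) ∘ (-g)` of `𝔤 ⊗ W(R)`. -/
def artinSchreier (R : Type*) [CommRing R] [CharP R p] (g : LieWitt p 𝔤 R) : LieWitt p 𝔤 R :=
  bch p (lieWittFrob p 𝔤 R g) (-g)

variable {p 𝔤}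

/-- The action `g.m = σ(g) ∘ m ∘ (-g)` of the group `(𝔤 ⊗ W(R), ∘)` on the set `𝔤 ⊗ W(R)`. -/
instance frobConjAction {R : Type*} [CommRing R] [CharP R p]
    (h : IsBCHGroupLaw p (LieWitt p 𝔤 R)) : MulAction (BCHGroup h) (LieWitt p 𝔤 R) where
  smul g m := bch p (bch p (lieWittFrob p 𝔤 R g.val) m) (-g.val)
  one_smul m := by
    change bch p (bch p (lieWittFrob p 𝔤 R 0) m) (-0) = m
    simp [h.zero_bch, h.bch_zero]
  mul_smul a b m := by
    have hinv : -(bch p a.val b.val) = bch p (-b.val) (-a.val) := mul_inv_rev a b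
    change bch p (bch p (lieWittFrob p 𝔤 R (bch p a.val b.val)) m) (-(bch p a.val b.val)) =
      bch p (bch p (lieWittFrob p 𝔤 R a.val)
        (bch p (bch p (lieWittFrob p 𝔤 R b.val) m) (-b.val))) (-a.val)
    rw [hinv, map_bch]
    simp only [h.assoc]

/-- The set of orbits of `𝔤 ⊗ W(R)` under the action `g.m = σ(g) ∘ m ∘ (-g)`. -/
abbrev FrobOrbits {R : Type*} [CommRing R] [CharP R p]
    (h : IsBCHGroupLaw p (LieWitt p 𝔤 R)) : Type _ :=
  MulAction.orbitRel.Quotient (BCHGroup h) (LieWitt p 𝔤 R)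

/-- The orbit of an element of `𝔤 ⊗ W(R)`. -/
def frobOrbit {R : Type*} [CommRing R] [CharP R p]
    (h : IsBCHGroupLaw p (LieWitt p 𝔤 R)) (m : LieWitt p 𝔤 R) : FrobOrbits h :=
  Quotient.mk _ m

end Witt

/-! ### Continuous cohomology with values in a group with trivial action -/

section Cohomology

variable (Γ G : Type*) [Group Γ] [TopologicalSpace Γ]
  [Group G] [TopologicalSpace G] [DiscreteTopology G]

/-- The action of `G` by conjugation on the set of continuous homomorphisms `Γ → G`. -/
instance homConjAction : MulAction G (Γ →ₜ* G) where
  smul g γ :=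
    { toMonoidHom := (MulAut.conj g).toMonoidHom.comp γ.toMonoidHom
      continuous_toFun :=
        (continuous_of_discreteTopology (f := fun x : G => g * x * g⁻¹)).comp
          γ.continuous_toFun }
  one_smul γ := by
    ext τ
    change 1 * γ τ * 1⁻¹ = γ τ
    simp
  mul_smul a b γ := by
    ext τ
    change (a * b) * γ τ * (a * b)⁻¹ = a * (b * γ τ * b⁻¹) * a⁻¹
    simp [mul_assoc]

/-- The set `H¹(Γ, G)` of conjugacy classes of continuous homomorphisms `Γ → G`. -/
abbrev H1Trivial : Type _ := MulAction.orbitRel.Quotient G (Γ →ₜ* G)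

variable {Γ G}

/-- The class in `H¹(Γ, G)` of a continuous homomorphism. -/
def h1Class (γ : Γ →ₜ* G) : H1Trivial Γ G := Quotient.mk _ γ

end Cohomology

/-! ### The Galois action -/

section Galois

variable (p : ℕ) [Fact p.Prime] (F Fsep : Type*) [Field F] [CharP F p] [Field Fsep] [CharP Fsep p]
  [Algebra F Fsep] (𝔤 : Type*) [LieRing 𝔤] [LieAlgebra ℤ_[p] 𝔤]

/-- The map `𝔤 ⊗ W(F^perf) → 𝔤 ⊗ W(F^alg)`, where `F^alg = (F^sep)^perf`. -/
def perfToAlg :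
    LieWitt p 𝔤 (PerfectClosure F p) →ₗ⁅ℤ_[p]⁆ LieWitt p 𝔤 (PerfectClosure Fsep p) :=
  lieWittMap p 𝔤 (perfMap p (algebraMap F Fsep))

variable {F Fsep}

/-- The action of an element of `Gal(F^sep|F)` on `𝔤 ⊗ W(F^alg)`, where `F^alg = (F^sep)^perf`. -/
def galAct (τ : Gal(Fsep/F)) :
    LieWitt p 𝔤 (PerfectClosure Fsep p) →ₗ⁅ℤ_[p]⁆ LieWitt p 𝔤 (PerfectClosure Fsep p) :=
  lieWittMap p 𝔤 (perfMap p (τ : Fsep →+* Fsep))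

variable {p 𝔤}

/-- The homomorphism `γ : Γ_F → (𝔤, ∘)` is `τ ↦ (-g) ∘ τ(g)`, for an element `g` of
`𝔤 ⊗ W(F^alg)`. -/
def IsGivenBy {hG : IsBCHGroupLaw p 𝔤} (γ : Gal(Fsep/F) →ₜ* BCHGroup hG)
    (g : LieWitt p 𝔤 (PerfectClosure Fsep p)) : Prop :=
  ∀ τ : Gal(Fsep/F),
    lieWittIncl p 𝔤 (PerfectClosure Fsep p) (γ τ).val = bch p (-g) (galAct p 𝔤 τ g)

end Galois

end

open scoped TensorProduct

noncomputable section

/-! ### Truncated exponential and logarithm -/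

section TruncatedExpLog

open Polynomial

/-! Two things are needed: that `∘` is a group law, and a Lang-type correspondence for the resulting
groups.

Group law. In an associative algebra with a multiplicative filtration vanishing in degree `p`, the
truncated exponential and logarithm are mutually inverse, and Dynkin's formula
(`bchTerm_eq_logTerm`) gives `exp (a ∘ b) = exp a * exp b`. The adjoint representation would
transport this to a Lie algebra, but it loses the centre. So `𝔤` is replaced by `ℤ_[p][X] ⊗ 𝔤`,
acting on itself enlarged by a symbol `∂` with `[∂, u] = X du/dX`. The operator of `u` then
determines `X du/dX`. This determines `u` when its constant coefficient is zero and its coefficient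
of `X ^ n` lies in step `n` of the filtration: `n` is a unit for `n < p`, and the step is zero for
`n ≥ p`. Evaluating at `X = 1` gives the group axioms (`LieFiltration.isBCHGroupLaw`).

Cohomology. A finite `𝔤` is an iterated central extension by groups of order `p`
(`finite_lie_induction`). For such an extension `𝔤 → 𝔥` and `R` a perfect domain, the kernel of `𝔤 ⊗
W(R) → 𝔥 ⊗ W(R)` is a copy of the additive group `R` (`teichTensor_injective`,
`exists_teichTensor_eq`), on which `∘` is addition. Statements about `𝔤 ⊗ W(F^alg)` thus reduce to
facts about `F^alg`: the roots of `x ^ p = x` form the prime field, `a ^ p - a = r` is solvable, the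
Galois invariants are `F^perf`, and continuous additive cocycles are coboundaries
(`exists_eq_perfAct_sub`).

The conclusion is formal (`LangDatum`). An element `g` links `γ` to `m` when `σ(g) = m ∘ g` and
`τ(g) = g ∘ γ(τ)`. Every `γ` and every `m` is linked to something. Two links from one `γ` differ by
`𝔤 ⊗ W(F^perf)` on the left, and two links to one `m` by `𝔤` on the right. Hence the bijection, and
conjugation by `g` identifies the two stabilizers inside `𝔤 ⊗ W(F^alg)`. -/

theorem PadicInt.isUnit_natCast_of_lt (p : ℕ) [Fact p.Prime] {n : ℕ} (h0 : 0 < n) (hn : n < p) :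
    IsUnit (n : ℤ_[p]) := by
  rw [PadicInt.isUnit_iff, PadicInt.norm_natCast_eq_one_iff]
  exact (Nat.coprime_of_lt_prime h0.ne' hn Fact.out)

theorem PadicInt.isUnit_factorial_of_lt (p : ℕ) [Fact p.Prime] {n : ℕ} (hn : n < p) :
    IsUnit (n.factorial : ℤ_[p]) := by
  induction n with
  | zero => simp
  | succ n ih =>
    rw [Nat.factorial_succ, Nat.cast_mul]
    exact (PadicInt.isUnit_natCast_of_lt p n.succ_pos hn).mul (ih (by omega))

variable (p : ℕ) [Fact p.Prime]

/-- The exponential series truncated in degree `p`. -/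
def expPoly : ℤ_[p][X] :=
  ∑ k ∈ Finset.range p, C (Ring.inverse (k.factorial : ℤ_[p])) * X ^ k

/-- The series of `log (1 + X)` truncated in degree `p`. -/
def logPoly : ℤ_[p][X] :=
  ∑ m ∈ Finset.Icc 1 (p - 1), C ((-1 : ℤ_[p]) ^ (m - 1) * Ring.inverse (m : ℤ_[p])) * X ^ m

theorem coeff_expPoly (k : ℕ) :
    (expPoly p).coeff k = if k < p then Ring.inverse (k.factorial : ℤ_[p]) else 0 := by
  simp [expPoly, coeff_X_pow]

theorem coeff_logPoly (m : ℕ) :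
    (logPoly p).coeff m =
      if m ∈ Finset.Icc 1 (p - 1) then (-1 : ℤ_[p]) ^ (m - 1) * Ring.inverse (m : ℤ_[p]) else 0 := by
  simp only [logPoly, finsetSum_coeff, coeff_C_mul, coeff_X_pow, mul_ite, mul_one, mul_zero,
    Finset.sum_ite_eq]

theorem X_dvd_logPoly : X ∣ logPoly p := by
  rw [X_dvd_iff, coeff_logPoly]; simp

theorem X_dvd_expPoly_sub_one : X ∣ expPoly p - 1 := by
  rw [X_dvd_iff, coeff_sub, coeff_expPoly]
  simp [(Fact.out : p.Prime).pos]

/-- With the next lemma, these are the differential equations `exp' = exp` and `(1 + X) log' = 1`,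
with explicit error terms of order `X ^ (p - 1)` caused by the truncation. -/
theorem derivative_expPoly :
    derivative (expPoly p) =
      expPoly p - C (Ring.inverse ((p - 1).factorial : ℤ_[p])) * X ^ (p - 1) := by
  have hp := (Fact.out : p.Prime).pos
  ext k
  rw [coeff_derivative, coeff_sub, coeff_C_mul, coeff_X_pow, coeff_expPoly, coeff_expPoly]
  rcases lt_trichotomy (k + 1) p with h | h | h
  · have hu := PadicInt.isUnit_factorial_of_lt p h
    have hu1 := PadicInt.isUnit_factorial_of_lt p (show k < p by omega)
    rw [if_pos h, if_pos (by omega), if_neg (by omega)]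
    simp only [mul_zero, sub_zero]
    rw [← hu1.mul_left_inj, ← hu.mul_right_inj, Ring.inverse_mul_cancel _ hu1, ← mul_assoc,
      ← mul_assoc, Ring.mul_inverse_cancel _ hu]
    push_cast [Nat.factorial_succ]; ring
  · have : k = p - 1 := by omega
    subst this
    rw [if_neg (by omega), if_pos (by omega), if_pos rfl]; simp
  · rw [if_neg (by omega), if_neg (by omega), if_neg (by omega)]; simp

theorem derivative_logPoly_mul :
    derivative (logPoly p) * (1 + X) = 1 - (-X) ^ (p - 1) := by
  have h : derivative (logPoly p) = ∑ i ∈ Finset.range (p - 1), (-X : ℤ_[p][X]) ^ i := by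
    ext k
    rw [coeff_derivative, coeff_logPoly, finsetSum_coeff]
    have : ∀ i, ((-X : ℤ_[p][X]) ^ i).coeff k = if k = i then (-1) ^ i else 0 := by
      intro i
      rw [neg_pow, show (-1 : ℤ_[p][X]) = C (-1) by simp, ← C_pow, coeff_C_mul, coeff_X_pow]
      simp
    simp only [this, Finset.sum_ite_eq, Finset.mem_range, Finset.mem_Icc]
    by_cases hk : k < p - 1
    · rw [if_pos (by omega), if_pos hk, mul_assoc]
      have hu := PadicInt.isUnit_natCast_of_lt p (n := k + 1) (by omega) (by omega)
      rw [← Nat.cast_succ, Nat.succ_eq_add_one, Ring.inverse_mul_cancel _ hu]; simp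
    · rw [if_neg (by omega), if_neg hk]; simp
  have := geom_sum_mul (-X : ℤ_[p][X]) (p - 1)
  rw [h]; linear_combination -this

/-- The difference has zero constant term, and by the chain rule its derivative is divisible by `X ^
(p - 1)`. Over `ℤ_[p]`, of characteristic zero, this forces the coefficients below `p` to vanish. -/
theorem X_pow_dvd_logPoly_comp :
    X ^ p ∣ (logPoly p).comp (expPoly p - 1) - X := by
  have hp := (Fact.out : p.Prime).pos
  set f := (logPoly p).comp (expPoly p - 1) - X with hf
  set c := C (Ring.inverse ((p - 1).factorial : ℤ_[p])) with hc
  obtain ⟨g, hg⟩ := X_dvd_expPoly_sub_one p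
  obtain ⟨l, hl⟩ := X_dvd_logPoly p
  have h1 := congrArg (fun q => q.comp (expPoly p - 1)) (derivative_logPoly_mul p)
  simp only [mul_comp, add_comp, sub_comp, one_comp, X_comp, pow_comp, neg_comp] at h1
  have hder : X ^ (p - 1) ∣ derivative f := by
    rw [hf, derivative_sub, derivative_comp, derivative_sub, derivative_expPoly, derivative_X,
      derivative_one, sub_zero, ← hc]
    rw [hg, ← hg]
    have h2 : (expPoly p - c * X ^ (p - 1)) * (derivative (logPoly p)).comp (expPoly p - 1) - 1 =
        X ^ (p - 1) * (-(-g) ^ (p - 1) - c * (derivative (logPoly p)).comp (expPoly p - 1)) := by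
      have h3 : (-(expPoly p - 1)) ^ (p - 1) = X ^ (p - 1) * (-g) ^ (p - 1) := by
        rw [hg, ← mul_pow]; ring
      rw [h3] at h1
      linear_combination h1
    exact ⟨_, h2⟩
  have h0 : f.coeff 0 = 0 := by
    rw [← X_dvd_iff, hf]
    refine dvd_sub ?_ dvd_rfl
    rw [hl, mul_comp, X_comp, hg, mul_assoc]
    exact dvd_mul_right _ _
  rw [X_pow_dvd_iff] at hder ⊢
  intro d hd
  cases d with
  | zero => exact h0
  | succ d =>
    have := hder d (by omega)
    rw [coeff_derivative] at this
    exact (mul_eq_zero.mp this).resolve_right (by exact_mod_cast d.succ_ne_zero)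

/-- The difference `f` satisfies `(1 + X) f' = f` modulo `X ^ (p - 1)`, which reads `(d + 1) f_(d+1)
= (1 - d) f_d` on coefficients. As `f_0 = 0`, induction kills every coefficient below `p`. -/
theorem X_pow_dvd_expPoly_comp :
    X ^ p ∣ (expPoly p).comp (logPoly p) - (1 + X) := by
  set f := (expPoly p).comp (logPoly p) - (1 + X) with hf
  set c := C (Ring.inverse ((p - 1).factorial : ℤ_[p])) with hc
  obtain ⟨g, hg⟩ := X_dvd_expPoly_sub_one p
  obtain ⟨l, hl⟩ := X_dvd_logPoly p
  have hder : X ^ (p - 1) ∣ (1 + X) * derivative f - f := by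
    have h1 := derivative_logPoly_mul p
    have h2 : derivative f = derivative (logPoly p) *
        ((expPoly p).comp (logPoly p) - c * (logPoly p) ^ (p - 1)) - 1 := by
      rw [hf, derivative_sub, derivative_comp, derivative_expPoly, derivative_add, derivative_one,
        derivative_X, zero_add, ← hc]
      simp [hc]
    have h3 : (logPoly p) ^ (p - 1) = X ^ (p - 1) * l ^ (p - 1) := by rw [hl, mul_pow]
    refine ⟨- (-1) ^ (p - 1) * (expPoly p).comp (logPoly p) -
      c * l ^ (p - 1) * (1 - (-X) ^ (p - 1)), ?_⟩
    have h4 : (-X : ℤ_[p][X]) ^ (p - 1) = (-1) ^ (p - 1) * X ^ (p - 1) := neg_pow _ _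
    rw [h2, h3, hf]
    rw [h4] at h1 ⊢
    linear_combination ((expPoly p).comp (logPoly p) - c * (X ^ (p - 1) * l ^ (p - 1))) * h1
  have h0 : f.coeff 0 = 0 := by
    have : (expPoly p).comp (logPoly p) = X * (l * g.comp (logPoly p)) + 1 := by
      rw [show expPoly p = X * g + 1 by rw [← hg]; ring]
      simp only [mul_comp, add_comp, X_comp, one_comp]
      nth_rewrite 1 [hl]; ring
    rw [← X_dvd_iff, hf, this]
    exact ⟨l * g.comp (logPoly p) - 1, by ring⟩
  rw [X_pow_dvd_iff] at hder ⊢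
  intro d
  induction d using Nat.strong_induction_on with
  | _ d ih =>
    intro hd
    cases d with
    | zero => exact h0
    | succ d =>
      have h5 := hder d (by omega)
      have h6 := ih d (by omega) (by omega)
      have h7 : (X * derivative f).coeff d = 0 := by
        cases d with
        | zero => simp
        | succ d => rw [coeff_X_mul, coeff_derivative, h6, zero_mul]
      rw [add_mul, one_mul, coeff_sub, coeff_add, h6, h7, coeff_derivative, add_zero,
        sub_zero] at h5
      exact (mul_eq_zero.mp h5).resolve_right (by exact_mod_cast d.succ_ne_zero)

variable {Q : Type*} [Ring Q] [Algebra ℤ_[p] Q]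

/-- The truncated exponential. -/
def texp (a : Q) : Q := aeval a (expPoly p)

/-- The truncated logarithm of `1 + u`. -/
def tlog (u : Q) : Q := aeval u (logPoly p)

theorem texp_eq_sum (a : Q) :
    texp p a = ∑ k ∈ Finset.range p, Ring.inverse (k.factorial : ℤ_[p]) • a ^ k := by
  simp [texp, expPoly, Algebra.smul_def]

theorem tlog_eq_sum (u : Q) :
    tlog p u = ∑ m ∈ Finset.Icc 1 (p - 1),
      ((-1 : ℤ_[p]) ^ (m - 1) * Ring.inverse (m : ℤ_[p])) • u ^ m := by
  simp [tlog, logPoly, Algebra.smul_def]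

variable {p}

theorem tlog_texp {a : Q} (ha : a ^ p = 0) : tlog p (texp p a - 1) = a := by
  obtain ⟨g, hg⟩ := X_pow_dvd_logPoly_comp p
  have := congrArg (aeval a) hg
  simpa [texp, tlog, aeval_comp, ha, sub_eq_zero] using this

theorem texp_tlog {u : Q} (hu : u ^ p = 0) : texp p (tlog p u) = 1 + u := by
  obtain ⟨g, hg⟩ := X_pow_dvd_expPoly_comp p
  have := congrArg (aeval u) hg
  simpa [texp, tlog, aeval_comp, hu, sub_eq_zero] using this

theorem texp_zero : texp p (0 : Q) = 1 := by
  have hp := (Fact.out : p.Prime).pos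
  simp [texp, aeval_def, eval₂_at_zero, coeff_expPoly, hp]

theorem map_texp {Q' : Type*} [Ring Q'] [Algebra ℤ_[p] Q'] (f : Q →ₐ[ℤ_[p]] Q') (a : Q) :
    f (texp p a) = texp p (f a) := by
  simp [texp, aeval_algHom_apply]

theorem texp_add {a b : Q} (hab : Commute a b) (h : ∀ i j, p ≤ i + j → a ^ i * b ^ j = 0) :
    texp p (a + b) = texp p a * texp p b := by
  have h1 : texp p (a + b) = ∑ n ∈ Finset.range p, ∑ ij ∈ Finset.HasAntidiagonal.antidiagonal n,
      (Ring.inverse (ij.1.factorial : ℤ_[p]) * Ring.inverse (ij.2.factorial : ℤ_[p])) •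
        (a ^ ij.1 * b ^ ij.2) := by
    rw [texp_eq_sum]
    refine Finset.sum_congr rfl fun n hn => ?_
    rw [hab.add_pow', Finset.smul_sum]
    refine Finset.sum_congr rfl fun ij hij => ?_
    rw [Finset.HasAntidiagonal.mem_antidiagonal] at hij
    rw [Finset.mem_range] at hn
    rw [← Nat.cast_smul_eq_nsmul ℤ_[p], smul_smul]
    congr 1
    have u1 := PadicInt.isUnit_factorial_of_lt p hn
    have u2 := PadicInt.isUnit_factorial_of_lt p (show ij.1 < p by omega)
    have u3 := PadicInt.isUnit_factorial_of_lt p (show ij.2 < p by omega)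
    rw [← u1.mul_right_inj, ← mul_assoc, Ring.mul_inverse_cancel _ u1, one_mul]
    have := Nat.add_choose_mul_factorial_mul_factorial ij.1 ij.2
    rw [hij, Nat.choose_symm_of_eq_add (hij.symm.trans (add_comm _ _))] at this
    rw [← this]
    push_cast
    have e2 := Ring.mul_inverse_cancel _ u2
    have e3 := Ring.mul_inverse_cancel _ u3
    linear_combination (-(n.choose ij.1 : ℤ_[p])) * e2 - (n.choose ij.1 : ℤ_[p]) *
      (ij.1.factorial * Ring.inverse (ij.1.factorial : ℤ_[p])) * e3
  rw [h1, texp_eq_sum, texp_eq_sum, Finset.sum_mul_sum, ← Finset.sum_product',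
    Finset.sum_sigma']
  -- The product of the two sums runs over the square `i, j < p`, the exponential of the sum over
  -- the triangle `i + j < p`. The terms outside the triangle vanish by `h`.
  refine Finset.sum_bij_ne_zero (fun x _ _ => x.2) ?_ ?_ ?_ ?_
  · rintro ⟨n, i, j⟩ hx -
    simp only [Finset.mem_sigma, Finset.mem_range, Finset.HasAntidiagonal.mem_antidiagonal] at hx
    simp only [Finset.mem_product, Finset.mem_range]
    omega
  · rintro ⟨n, i, j⟩ hx - ⟨n', i', j'⟩ hx' - heq
    simp only [Finset.mem_sigma, Finset.mem_range, Finset.HasAntidiagonal.mem_antidiagonal] at hx hx'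
    simp only [Prod.mk.injEq] at heq
    obtain ⟨rfl, rfl⟩ := heq
    obtain ⟨-, rfl⟩ := hx
    obtain ⟨-, rfl⟩ := hx'
    rfl
  · rintro ⟨i, j⟩ hx hne
    have hlt : i + j < p := by
      by_contra hcon
      apply hne
      simp only
      rw [smul_mul_smul_comm, h i j (by omega), smul_zero]
    refine ⟨⟨i + j, i, j⟩, ?_, ?_, rfl⟩
    · simp [hlt]
    · simpa only [smul_mul_smul_comm] using hne
  · rintro ⟨n, i, j⟩ hx -
    simp only [smul_mul_smul_comm]

end TruncatedExpLog

/-! ### Nilpotent filtrations and the expansion of `log (exp a * exp b)` -/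

theorem Finset.sum_pow_eq_sum_prod_ofFn {ι Q : Type*} [Semiring Q] (s : Finset ι) (f : ι → Q)
    (m : ℕ) :
    (∑ i ∈ s, f i) ^ m =
      ∑ e ∈ Fintype.piFinset (fun _ : Fin m => s), (List.ofFn fun i => f (e i)).prod := by
  induction m with
  | zero => simp
  | succ m ih =>
    rw [pow_succ', ih, Finset.sum_mul_sum, ← Finset.sum_product']
    refine Finset.sum_nbij' (fun x => (Fin.cons x.1 x.2 : Fin (m + 1) → ι))
      (fun e => (e 0, Fin.tail e)) ?_ ?_ ?_ ?_ ?_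
    · rintro ⟨i, e⟩ h
      simp only [Finset.mem_product, Fintype.mem_piFinset] at h ⊢
      exact Fin.cases h.1 h.2
    · intro e h
      simp only [Finset.mem_product, Fintype.mem_piFinset] at h ⊢
      exact ⟨h 0, fun i => h i.succ⟩
    · rintro ⟨i, e⟩ _
      simp
    · intro e _
      simp
    · rintro ⟨i, e⟩ _
      simp [List.ofFn_succ]

theorem List.prod_ofFn_smul {R Q : Type*} [CommSemiring R] [Semiring Q] [Algebra R Q] {m : ℕ}
    (c : Fin m → R) (f : Fin m → Q) :
    (List.ofFn fun i => c i • f i).prod = (∏ i, c i) • (List.ofFn f).prod := by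
  induction m with
  | zero => simp
  | succ m ih =>
    simp only [List.ofFn_succ, Fin.prod_univ_succ, ih, List.prod_cons, smul_mul_smul_comm]

/-- A multiplicative filtration with `E p = 0` on a `ℤ_[p]`-algebra. -/
structure NilFiltration (p : ℕ) [Fact p.Prime] (Q : Type*) [Ring Q] [Algebra ℤ_[p] Q] where
  /-- The pieces of the filtration. -/
  E : ℕ → Submodule ℤ_[p] Q
  anti : Antitone E
  mul_mem : ∀ {i j : ℕ} {a b : Q}, a ∈ E i → b ∈ E j → a * b ∈ E (i + j)
  one_mem : (1 : Q) ∈ E 0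
  eq_zero : ∀ {a : Q}, a ∈ E p → a = 0

namespace NilFiltration

open Polynomial

variable {p : ℕ} [Fact p.Prime] {Q : Type*} [Ring Q] [Algebra ℤ_[p] Q] (N : NilFiltration p Q)
  {a b u : Q}

theorem pow_mem {i : ℕ} (ha : a ∈ N.E i) (k : ℕ) : a ^ k ∈ N.E (i * k) := by
  induction k with
  | zero => simpa using N.one_mem
  | succ k ih => rw [pow_succ, mul_add, mul_one]; exact N.mul_mem ih ha

theorem pow_mem_one (ha : a ∈ N.E 1) (k : ℕ) : a ^ k ∈ N.E k := by
  simpa using N.pow_mem ha k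

theorem pow_eq_zero (ha : a ∈ N.E 1) : a ^ p = 0 := N.eq_zero (N.pow_mem_one ha p)

theorem aeval_mem (ha : a ∈ N.E 1) (f : ℤ_[p][X]) : aeval a f ∈ N.E 0 := by
  rw [aeval_eq_sum_range]
  exact Submodule.sum_mem _ fun i _ =>
    Submodule.smul_mem _ _ (N.anti (Nat.zero_le _) (N.pow_mem_one ha i))

theorem aeval_mem_one (ha : a ∈ N.E 1) {f : ℤ_[p][X]} (hf : X ∣ f) : aeval a f ∈ N.E 1 := by
  obtain ⟨g, rfl⟩ := hf
  rw [map_mul, aeval_X]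
  exact N.mul_mem ha (N.aeval_mem ha g)

theorem texp_sub_one_mem (ha : a ∈ N.E 1) : texp p a - 1 ∈ N.E 1 := by
  simpa [texp] using N.aeval_mem_one ha (X_dvd_expPoly_sub_one p)

theorem tlog_mem (hu : u ∈ N.E 1) : tlog p u ∈ N.E 1 := N.aeval_mem_one hu (X_dvd_logPoly p)

theorem mul_sub_one_mem (ha : a - 1 ∈ N.E 1) (hb : b - 1 ∈ N.E 1) : a * b - 1 ∈ N.E 1 := by
  have : a * b - 1 = (a - 1) * (b - 1) + (a - 1) + (b - 1) := by noncomm_ring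
  rw [this]
  exact add_mem (add_mem (N.anti one_le_two (N.mul_mem ha hb)) ha) hb

theorem texp_injective (ha : a ∈ N.E 1) (hb : b ∈ N.E 1) (h : texp p a = texp p b) : a = b := by
  rw [← tlog_texp (N.pow_eq_zero ha), h, tlog_texp (N.pow_eq_zero hb)]

theorem texp_tlog_sub_one (hu : u - 1 ∈ N.E 1) : texp p (tlog p (u - 1)) = u := by
  rw [texp_tlog (N.pow_eq_zero hu), add_sub_cancel]

theorem texp_add_of_commute (ha : a ∈ N.E 1) (hb : b ∈ N.E 1) (hab : Commute a b) :
    texp p (a + b) = texp p a * texp p b :=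
  texp_add hab fun i j hij =>
    N.eq_zero (N.anti hij (N.mul_mem (N.pow_mem_one ha i) (N.pow_mem_one hb j)))

theorem texp_mul_texp_neg (ha : a ∈ N.E 1) : texp p a * texp p (-a) = 1 := by
  rw [← N.texp_add_of_commute ha (neg_mem ha) (Commute.neg_right (Commute.refl a)),
    add_neg_cancel, texp_zero]

theorem texp_neg_mul_texp (ha : a ∈ N.E 1) : texp p (-a) * texp p a = 1 := by
  simpa using N.texp_mul_texp_neg (neg_mem ha)

end NilFiltration

section LogTerm

variable (p : ℕ) [Fact p.Prime] {Q : Type*} [Ring Q] [Algebra ℤ_[p] Q]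

/-- The homogeneous part of degree `n` of `log (exp a * exp b)`, in an associative algebra. -/
def logTerm (n : ℕ) (a b : Q) : Q :=
  ∑ m ∈ Finset.Icc 1 n,
    ∑ e : Fin m → Fin (n + 1) × Fin (n + 1) with
      (∀ i, 0 < ((e i).1 : ℕ) + ((e i).2 : ℕ)) ∧ ∑ i, (((e i).1 : ℕ) + ((e i).2 : ℕ)) = n,
      ((-1 : ℤ_[p]) ^ (m - 1) *
        Ring.inverse ((m * ∏ i, Nat.factorial (e i).1 * Nat.factorial (e i).2 : ℕ) : ℤ_[p])) •
        (dynkinWord a b e).prod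

theorem prod_dynkinWord {M : Type*} [Monoid M] (a b : M) {m n : ℕ} (e : Fin m → Fin n × Fin n) :
    (dynkinWord a b e).prod = (List.ofFn fun i => a ^ ((e i).1 : ℕ) * b ^ ((e i).2 : ℕ)).prod := by
  simp [dynkinWord, List.prod_flatten, List.map_ofFn, Function.comp_def]

variable {p}

/-- Each power of `exp a * exp b - 1` is expanded into words and sorted by total degree. The
filtration kills the degrees `≥ p`. -/
theorem NilFiltration.tlog_texp_mul_texp (N : NilFiltration p Q) {a b : Q} (ha : a ∈ N.E 1)
    (hb : b ∈ N.E 1) :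
    tlog p (texp p a * texp p b - 1) = ∑ n ∈ Finset.Icc 1 (p - 1), logTerm p n a b := by
  have hp := (Fact.out : p.Prime).pos
  set c : ℕ × ℕ → ℤ_[p] := fun x =>
    Ring.inverse (x.1.factorial : ℤ_[p]) * Ring.inverse (x.2.factorial : ℤ_[p]) with hc
  set f : ℕ × ℕ → Q := fun x => a ^ x.1 * b ^ x.2 with hf
  -- Leaving out the exponent pair `(0, 0)` accounts for the `- 1`, and makes every factor have
  -- degree at least one.
  set S : Finset (ℕ × ℕ) := (Finset.range p ×ˢ Finset.range p).filter (fun x => 0 < x.1 + x.2)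
    with hS
  have hfm : ∀ x, f x ∈ N.E (x.1 + x.2) := fun x =>
    N.mul_mem (N.pow_mem_one ha _) (N.pow_mem_one hb _)
  have h1 : texp p a * texp p b - 1 = ∑ x ∈ S, c x • f x := by
    rw [texp_eq_sum, texp_eq_sum, Finset.sum_mul_sum, ← Finset.sum_product']
    rw [← Finset.sum_filter_add_sum_filter_not _ (fun x : ℕ × ℕ => 0 < x.1 + x.2)]
    have : (Finset.range p ×ˢ Finset.range p).filter (fun x : ℕ × ℕ => ¬ 0 < x.1 + x.2) =
        {(0, 0)} := by
      ext ⟨i, j⟩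
      simp only [Finset.mem_filter, Finset.mem_product, Finset.mem_range, Finset.mem_singleton,
        Prod.mk.injEq]
      omega
    rw [this]
    simp only [smul_mul_smul_comm]
    simp [hc, hf, hS]
  have hprod : ∀ {m : ℕ} (e : Fin m → ℕ × ℕ),
      (List.ofFn fun i => f (e i)).prod ∈ N.E (∑ i, ((e i).1 + (e i).2)) := by
    intro m
    induction m with
    | zero => intro e; simpa using N.one_mem
    | succ m ih =>
      intro e
      rw [List.ofFn_succ, List.prod_cons, Fin.sum_univ_succ]
      exact N.mul_mem (hfm _) (ih _)
  have h2 : ∀ m ∈ Finset.Icc 1 (p - 1), (texp p a * texp p b - 1) ^ m =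
      ∑ n ∈ Finset.Icc 1 (p - 1), ∑ e ∈ (Fintype.piFinset (fun _ : Fin m => S)).filter
        (fun e => ∑ i, ((e i).1 + (e i).2) = n),
        (∏ i, c (e i)) • (List.ofFn fun i => f (e i)).prod := by
    intro m hm
    rw [Finset.mem_Icc] at hm
    rw [h1, Finset.sum_pow_eq_sum_prod_ofFn]
    simp only [List.prod_ofFn_smul]
    simp only [Finset.sum_filter]
    rw [Finset.sum_comm]
    refine Finset.sum_congr rfl fun e he => ?_
    rw [Finset.sum_ite_eq]
    split_ifs with hd
    · rfl
    · rw [Finset.mem_Icc, not_and_or] at hd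
      have hge : m ≤ ∑ i, ((e i).1 + (e i).2) := by
        calc m = ∑ _i : Fin m, 1 := by simp
          _ ≤ _ := Finset.sum_le_sum fun i _ => by
            have := Fintype.mem_piFinset.mp he i
            rw [hS, Finset.mem_filter] at this
            exact this.2
      rw [N.eq_zero (N.anti (show p ≤ _ by omega) (hprod e)), smul_zero]
  rw [tlog_eq_sum, Finset.sum_congr rfl fun m hm => by rw [h2 m hm, Finset.smul_sum],
    Finset.sum_comm]
  refine Finset.sum_congr rfl fun n hn => ?_
  rw [Finset.mem_Icc] at hn
  rw [logTerm]
  symm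
  -- A product of `m > n` factors of positive degree cannot have degree `n`, so the range of `m` may
  -- be extended to `p - 1`.
  rw [Finset.sum_subset (Finset.Icc_subset_Icc_right hn.2)]
  · refine Finset.sum_congr rfl fun m hm => ?_
    rw [Finset.smul_sum]
    refine Finset.sum_bij (fun e _ i => (((e i).1 : ℕ), ((e i).2 : ℕ))) ?_ ?_ ?_ ?_
    · intro e he
      simp only [Finset.mem_filter, Finset.mem_univ, true_and, Fintype.mem_piFinset, hS,
        Finset.mem_product, Finset.mem_range] at he ⊢
      exact ⟨fun i => ⟨⟨by omega, by omega⟩, he.1 i⟩, he.2⟩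
    · intro e _ e' _ h
      funext i
      have := congrFun h i
      simp only [Prod.mk.injEq] at this
      exact Prod.ext (Fin.ext this.1) (Fin.ext this.2)
    · intro e he
      simp only [Finset.mem_filter, Fintype.mem_piFinset, hS] at he
      have hle : ∀ i, (e i).1 + (e i).2 ≤ n := fun i => by
        rw [← he.2]
        exact Finset.single_le_sum (f := fun i => (e i).1 + (e i).2) (fun _ _ => Nat.zero_le _)
          (Finset.mem_univ i)
      refine ⟨fun i => (⟨(e i).1, by have := hle i; omega⟩, ⟨(e i).2, by have := hle i; omega⟩),
        ?_, rfl⟩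
      simp only [Finset.mem_filter, Finset.mem_univ, true_and]
      exact ⟨fun i => (he.1 i).2, he.2⟩
    · intro e he
      rw [prod_dynkinWord, smul_smul]
      congr 1
      rw [mul_assoc]
      congr 1
      simp only [hc]
      push_cast
      rw [Ring.mul_inverse_rev]
      have : ∀ {m : ℕ} (g : Fin m → ℤ_[p]),
          Ring.inverse (∏ i, g i) = ∏ i, Ring.inverse (g i) := by
        intro m
        induction m with
        | zero => simp
        | succ m ih => intro g; simp [Fin.prod_univ_succ, Ring.mul_inverse_rev, ih, mul_comm]
      rw [this, mul_comm]
      congr 1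
      refine Finset.prod_congr rfl fun i _ => ?_
      rw [Ring.mul_inverse_rev, mul_comm]
  · intro m hm hmn
    rw [Finset.mem_Icc] at hm hmn
    refine Finset.sum_eq_zero fun e he => ?_
    exfalso
    simp only [Finset.mem_filter, Finset.mem_univ, true_and] at he
    have hge : m ≤ ∑ i, (((e i).1 : ℕ) + ((e i).2 : ℕ)) := by
      calc m = ∑ _i : Fin m, 1 := by simp
        _ ≤ _ := Finset.sum_le_sum fun i _ => he.1 i
    omega

end LogTerm

/-! ### Dynkin's formula in an associative algebra -/

theorem List.map_dynkinWord_eq {α β : Type*} (f : α → β) (x y : α) {m n : ℕ}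
    (e : Fin m → Fin n × Fin n) : (dynkinWord x y e).map f = dynkinWord (f x) (f y) e := by
  simp [dynkinWord, List.map_flatten, List.map_ofFn, Function.comp_def]

theorem length_dynkinWord {α : Type*} (x y : α) {m n : ℕ} (e : Fin m → Fin n × Fin n) :
    (dynkinWord x y e).length = ∑ i, (((e i).1 : ℕ) + ((e i).2 : ℕ)) := by
  simp [dynkinWord, List.length_flatten, List.map_ofFn, Function.comp_def, List.sum_ofFn]

theorem mem_dynkinWord {α : Type*} {x y z : α} {m n : ℕ} {e : Fin m → Fin n × Fin n}
    (hz : z ∈ dynkinWord x y e) : z = x ∨ z = y := by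
  simp only [dynkinWord, List.mem_flatten, List.mem_ofFn] at hz
  obtain ⟨_, ⟨i, rfl⟩, hz⟩ := hz
  rw [List.mem_append, List.mem_replicate, List.mem_replicate] at hz
  tauto

/-- A decreasing filtration `F 0 = M ⊇ ⋯ ⊇ F p = 0` on a `ℤ_[p]`-module. -/
structure ModFiltration (p : ℕ) [Fact p.Prime] (M : Type*) [AddCommGroup M] [Module ℤ_[p] M] where
  /-- The pieces of the filtration. -/
  F : ℕ → Submodule ℤ_[p] M
  anti : Antitone F
  mem_zero : ∀ x, x ∈ F 0
  eq_zero : ∀ {x}, x ∈ F p → x = 0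

/-- The filtration of the endomorphisms of a filtered module. -/
def ModFiltration.endo {p : ℕ} [Fact p.Prime] {M : Type*} [AddCommGroup M] [Module ℤ_[p] M]
    (Φ : ModFiltration p M) : NilFiltration p (Module.End ℤ_[p] M) where
  E i :=
    { carrier := {f | ∀ k, ∀ m ∈ Φ.F k, f m ∈ Φ.F (k + i)}
      add_mem' := fun ha hb k m hm => add_mem (ha k m hm) (hb k m hm)
      zero_mem' := fun _ _ _ => zero_mem _
      smul_mem' := fun c _ ha k m hm => Submodule.smul_mem _ c (ha k m hm) }
  anti i j hij f hf k m hm := Φ.anti (by omega) (hf k m hm)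
  mul_mem {i j a b} ha hb k m hm := by
    have := ha _ _ (hb k m hm)
    rwa [add_assoc, add_comm j i] at this
  one_mem k m hm := hm
  eq_zero {f} hf := by
    ext m
    have := hf 0 m (Φ.mem_zero m)
    rw [zero_add] at this
    exact Φ.eq_zero this

namespace NilFiltration

variable {p : ℕ} [Fact p.Prime] {Q : Type*} [Ring Q] [Algebra ℤ_[p] Q] (N : NilFiltration p Q)

/-- The opposite of a filtration. -/
def op : NilFiltration p Qᵐᵒᵖ where
  E i := (N.E i).comap (MulOpposite.opLinearEquiv ℤ_[p]).symm.toLinearMap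
  anti i j hij f hf := N.anti hij hf
  mul_mem {i j a b} ha hb := by
    rw [add_comm]
    exact N.mul_mem (a := b.unop) (b := a.unop) hb ha
  one_mem := N.one_mem
  eq_zero {a} ha := MulOpposite.unop_injective (N.eq_zero ha)

open Polynomial

/-- The induced filtration on polynomials. -/
def poly : NilFiltration p Q[X] where
  E i :=
    { carrier := {f | ∀ n, f.coeff n ∈ N.E i}
      add_mem' := fun ha hb n => by rw [coeff_add]; exact add_mem (ha n) (hb n)
      zero_mem' := fun _ => by rw [coeff_zero]; exact zero_mem _
      smul_mem' := fun c _ ha n => by rw [coeff_smul]; exact Submodule.smul_mem _ c (ha n) }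
  anti i j hij f hf n := N.anti hij (hf n)
  mul_mem {i j a b} ha hb n := by
    rw [coeff_mul]
    exact Submodule.sum_mem _ fun x _ => N.mul_mem (ha _) (hb _)
  one_mem n := by
    rw [coeff_one]
    split_ifs
    exacts [N.one_mem, zero_mem _]
  eq_zero {f} hf := by
    ext n
    exact N.eq_zero (hf n)

end NilFiltration

/-! ### The commutator action on `Q[X] ⊕ Q[X]∂` -/

section EulerModule

open Polynomial MulOpposite

attribute [local instance] LieRing.ofAssociativeRing

variable (p : ℕ) [Fact p.Prime] {Q : Type*} [Ring Q] [Algebra ℤ_[p] Q]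

/-- The Euler derivation `X d/dX`. -/
def eulerDer (f : Q[X]) : Q[X] := X * derivative f

theorem eulerDer_mul (f g : Q[X]) : eulerDer (f * g) = eulerDer f * g + f * eulerDer g := by
  rw [eulerDer, eulerDer, eulerDer, derivative_mul, mul_add, mul_assoc, ← mul_assoc X f,
    X_mul (p := f), mul_assoc f]

theorem eulerDer_add (f g : Q[X]) : eulerDer (f + g) = eulerDer f + eulerDer g := by
  simp [eulerDer, mul_add]

theorem eulerDer_smul (c : ℤ_[p]) (f : Q[X]) : eulerDer (c • f) = c • eulerDer f := by
  simp [eulerDer]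

theorem eulerDer_monomial (n : ℕ) (q : Q) :
    eulerDer (monomial n q) = monomial n ((n : ℤ_[p]) • q) := by
  cases n with
  | zero => simp [eulerDer]
  | succ n =>
    rw [eulerDer, derivative_monomial, X_mul_monomial, Nat.add_sub_cancel, Nat.cast_smul_eq_nsmul,
      nsmul_eq_mul, Nat.cast_comm]

/-- Left multiplication on the bimodule `Q[X] ⊕ Q[X]∂`. -/
def leftOp : Q[X] →ₐ[ℤ_[p]] Module.End ℤ_[p] (Q[X] × Q[X]) where
  toFun u :=
    { toFun := fun x => (u * x.1, u * x.2)
      map_add' := fun x y => by simp [mul_add]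
      map_smul' := fun c x => by simp }
  map_one' := by ext <;> simp
  map_mul' u v := LinearMap.ext fun x => by simp [mul_assoc]
  map_zero' := LinearMap.ext fun x => by simp
  map_add' u v := LinearMap.ext fun x => by simp [add_mul]
  commutes' c := LinearMap.ext fun x => by
    rw [Module.algebraMap_end_apply]
    exact Prod.ext (Algebra.smul_def c x.1).symm (Algebra.smul_def c x.2).symm

/-- Right multiplication on the bimodule `Q[X] ⊕ Q[X]∂`, where `∂ u = u ∂ + X u'`. -/
def rightOp : Q[X] →ₐ[ℤ_[p]] (Module.End ℤ_[p] (Q[X] × Q[X]))ᵐᵒᵖ where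
  toFun u := op
    { toFun := fun x => (x.1 * u + x.2 * eulerDer u, x.2 * u)
      map_add' := fun x y => by
        simp only [Prod.fst_add, Prod.snd_add, add_mul, Prod.mk_add_mk]; congr 1; abel
      map_smul' := fun c x => by simp }
  map_one' := by
    apply unop_injective
    refine LinearMap.ext fun x => ?_
    simp [eulerDer]
  map_mul' u v := by
    apply unop_injective
    refine LinearMap.ext fun x => ?_
    simp [eulerDer_mul, mul_add, add_mul, mul_assoc]; abel
  map_zero' := by
    apply unop_injective
    refine LinearMap.ext fun x => ?_
    simp [eulerDer]
  map_add' u v := by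
    apply unop_injective
    refine LinearMap.ext fun x => ?_
    simp [eulerDer_add, mul_add]; abel
  commutes' c := by
    apply unop_injective
    refine LinearMap.ext fun x => ?_
    have : eulerDer (algebraMap ℤ_[p] Q[X] c) = 0 := by
      rw [Algebra.algebraMap_eq_smul_one, eulerDer_smul]; simp [eulerDer]
    simp only [unop_op, LinearMap.coe_mk, AddHom.coe_mk, this, mul_zero, add_zero]
    rw [← Algebra.commutes, ← Algebra.commutes, ← Algebra.smul_def, ← Algebra.smul_def,
      MulOpposite.algebraMap_apply, unop_op, Module.algebraMap_end_apply]
    rfl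

/-- The commutator with `u`, acting from the right on `Q[X] ⊕ Q[X]∂`. -/
def commOp : Q[X] →ₗ[ℤ_[p]] (Module.End ℤ_[p] (Q[X] × Q[X]))ᵐᵒᵖ :=
  (rightOp p).toLinearMap - (opLinearEquiv ℤ_[p]).toLinearMap ∘ₗ (leftOp p).toLinearMap

theorem commOp_apply (u : Q[X]) : commOp p u = rightOp p u - op (leftOp p u) := rfl

theorem commute_rightOp_leftOp (u v : Q[X]) : Commute (rightOp p u) (op (leftOp p v)) := by
  apply unop_injective
  refine LinearMap.ext fun x => ?_
  simp [rightOp, leftOp, mul_assoc, mul_add]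

/-- The pair `(0, 1)` is `∂`, so this is the relation `[∂, u] = X u'`. -/
theorem unop_commOp_partial (u : Q[X]) : (commOp p u).unop (0, 1) = (eulerDer u, 0) := by
  simp [commOp_apply, rightOp, leftOp]

theorem unop_commOp_fst (u f : Q[X]) : (commOp p u).unop (f, 0) = (⁅f, u⁆, 0) := by
  simp [commOp_apply, rightOp, leftOp, Ring.lie_def]

/-- Since the operators live in the opposite algebra, the first letter of a word acts first, and a
product of commutators becomes a left-normed bracket. -/
theorem unop_prod_map_commOp (l : List Q[X]) (f : Q[X]) :
    (l.map (commOp p)).prod.unop (f, 0) = (l.foldl (fun u v => ⁅u, v⁆) f, 0) := by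
  induction l generalizing f with
  | nil => simp
  | cons v l ih => simp [unop_commOp_fst, ih]

/-- The first letter turns `∂` into itself when it is homogeneous of degree one. The remaining
letters then build the left-normed bracket on it. -/
theorem unop_prod_map_commOp_partial {l : List Q[X]} (hl : l ≠ [])
    (h : ∀ u ∈ l, eulerDer u = u) :
    (l.map (commOp p)).prod.unop (0, 1) = (leftBracket l, 0) := by
  cases l with
  | nil => exact absurd rfl hl
  | cons v l =>
    simp [unop_commOp_partial, h v List.mem_cons_self, unop_prod_map_commOp, leftBracket]

variable {p}

theorem texp_op {A : Type*} [Ring A] [Algebra ℤ_[p] A] (a : A) : texp p (op a) = op (texp p a) := by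
  simp [texp_eq_sum]

variable (N : NilFiltration p Q)

/-- The filtration of the bimodule `Q[X] ⊕ Q[X]∂`. -/
def eulerFiltration (hN : ∀ x, x ∈ N.E 0) : ModFiltration p (Q[X] × Q[X]) where
  F k := (N.poly.E k).prod (N.poly.E k)
  anti _ _ hij _ hx := ⟨N.poly.anti hij hx.1, N.poly.anti hij hx.2⟩
  mem_zero _ := ⟨fun _ => hN _, fun _ => hN _⟩
  eq_zero hx := Prod.ext (N.poly.eq_zero hx.1) (N.poly.eq_zero hx.2)

theorem eulerDer_mem {k : ℕ} {u : Q[X]} (hu : u ∈ N.poly.E k) : eulerDer u ∈ N.poly.E k := by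
  intro n
  cases n with
  | zero => simp [eulerDer]
  | succ n =>
    rw [eulerDer, coeff_X_mul, coeff_derivative, ← Nat.cast_succ, ← Nat.cast_comm, ← nsmul_eq_mul]
    exact nsmul_mem (hu _) _

theorem rightOp_mem (hN : ∀ x, x ∈ N.E 0) {k : ℕ} {u : Q[X]} (hu : u ∈ N.poly.E k) :
    rightOp p u ∈ (eulerFiltration N hN).endo.op.E k := fun _ _ hm =>
  ⟨add_mem (N.poly.mul_mem hm.1 hu) (N.poly.mul_mem hm.2 (eulerDer_mem N hu)),
    N.poly.mul_mem hm.2 hu⟩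

theorem op_leftOp_mem (hN : ∀ x, x ∈ N.E 0) {k : ℕ} {u : Q[X]} (hu : u ∈ N.poly.E k) :
    op (leftOp p u) ∈ (eulerFiltration N hN).endo.op.E k := fun i m hm => by
  rw [add_comm i k]
  exact ⟨N.poly.mul_mem hu hm.1, N.poly.mul_mem hu hm.2⟩

theorem commOp_mem (hN : ∀ x, x ∈ N.E 0) {k : ℕ} {u : Q[X]} (hu : u ∈ N.poly.E k) :
    commOp p u ∈ (eulerFiltration N hN).endo.op.E k :=
  sub_mem (rightOp_mem N hN hu) (op_leftOp_mem N hN hu)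

/-- The commutator operator is the sum of two commuting operators, right multiplication by `u` and
left multiplication by `-u`. -/
theorem texp_commOp (hN : ∀ x, x ∈ N.E 0) {u : Q[X]} (hu : u ∈ N.poly.E 1) :
    texp p (commOp p u) = rightOp p (texp p u) * op (leftOp p (texp p (-u))) := by
  rw [map_texp, map_texp, ← texp_op, ← (eulerFiltration N hN).endo.op.texp_add_of_commute
    (rightOp_mem N hN hu) (op_leftOp_mem N hN (neg_mem hu)) (commute_rightOp_leftOp p _ _),
    commOp_apply, map_neg, op_neg, sub_eq_add_neg]

/-- Exponentiating the left side gives right multiplication by `exp a * exp b` combined with left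
multiplication by its inverse. Regrouping the commuting left and right factors yields the product of
the exponentials of the two commutator operators. -/
theorem commOp_tlog (hN : ∀ x, x ∈ N.E 0) {a b : Q[X]} (ha : a ∈ N.poly.E 1)
    (hb : b ∈ N.poly.E 1) :
    commOp p (tlog p (texp p a * texp p b - 1)) =
      tlog p (texp p (commOp p a) * texp p (commOp p b) - 1) := by
  have h1 := N.poly.mul_sub_one_mem (N.poly.texp_sub_one_mem ha) (N.poly.texp_sub_one_mem hb)
  set l := tlog p (texp p a * texp p b - 1) with hl
  have hlm : l ∈ N.poly.E 1 := N.poly.tlog_mem h1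
  have hle : texp p l = texp p a * texp p b := N.poly.texp_tlog_sub_one h1
  have hln : texp p (-l) = texp p (-b) * texp p (-a) := by
    have h2 : texp p l * (texp p (-b) * texp p (-a)) = 1 := by
      rw [hle, mul_assoc, ← mul_assoc (texp p b), N.poly.texp_mul_texp_neg hb, one_mul,
        N.poly.texp_mul_texp_neg ha]
    calc texp p (-l) = texp p (-l) * (texp p l * (texp p (-b) * texp p (-a))) := by
          rw [h2, mul_one]
      _ = _ := by rw [← mul_assoc, N.poly.texp_neg_mul_texp hlm, one_mul]
  rw [← tlog_texp ((eulerFiltration N hN).endo.op.pow_eq_zero (commOp_mem N hN hlm)),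
    texp_commOp N hN hlm, texp_commOp N hN ha, texp_commOp N hN hb, hle, hln]
  congr 2
  rw [map_mul, map_mul, op_mul, mul_assoc, mul_assoc]
  congr 1
  rw [← mul_assoc, ← mul_assoc, (commute_rightOp_leftOp p _ _).eq]

end EulerModule

section Dynkin

open Polynomial MulOpposite

attribute [local instance] LieRing.ofAssociativeRing

variable {p : ℕ} [Fact p.Prime] {Q : Type*} [Ring Q] [Algebra ℤ_[p] Q]

theorem prod_map_monomial_one (l : List Q) :
    (l.map (monomial 1)).prod = monomial l.length l.prod := by
  induction l with
  | nil => simp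
  | cons a l ih => rw [List.map_cons, List.prod_cons, ih, monomial_mul_monomial, List.length_cons,
      List.prod_cons, add_comm]

theorem leftBracket_map_monomial_one (l : List Q) :
    leftBracket (l.map (monomial 1)) = monomial l.length (leftBracket l) := by
  cases l with
  | nil => simp [leftBracket]
  | cons a l =>
    simp only [leftBracket, List.map_cons, List.length_cons]
    suffices h : ∀ k (a : Q), (l.map (monomial 1)).foldl (fun u v => ⁅u, v⁆) (monomial k a) =
        monomial (l.length + k) (l.foldl (fun u v => ⁅u, v⁆) a) from h 1 a
    induction l with
    | nil => simp
    | cons b l ih =>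
      intro k a
      have : ⁅(monomial k a : Q[X]), monomial 1 b⁆ = monomial (k + 1) ⁅a, b⁆ := by
        rw [Ring.lie_def, Ring.lie_def, monomial_mul_monomial, monomial_mul_monomial, add_comm 1 k,
          map_sub]
      simp only [List.map_cons, List.foldl_cons, this, ih, List.length_cons]
      rw [add_assoc, add_comm 1 k]

theorem logTerm_monomial_one (n : ℕ) (a b : Q) :
    logTerm p n (monomial 1 a : Q[X]) (monomial 1 b) = monomial n (logTerm p n a b) := by
  simp only [logTerm, map_sum]
  refine Finset.sum_congr rfl fun m _ => Finset.sum_congr rfl fun e he => ?_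
  rw [Finset.mem_filter] at he
  rw [← List.map_dynkinWord_eq (monomial 1), prod_map_monomial_one, length_dynkinWord, he.2.2,
    smul_monomial]

theorem inverse_natCast_mul {n : ℕ} (h0 : 0 < n) (hn : n < p) (k : ℕ) :
    (n : ℤ_[p]) * Ring.inverse ((n * k : ℕ) : ℤ_[p]) = Ring.inverse (k : ℤ_[p]) := by
  have := PadicInt.isUnit_natCast_of_lt p h0 hn
  rw [Nat.cast_mul, Ring.mul_inverse_rev, mul_left_comm, Ring.mul_inverse_cancel _ this, mul_one]

/-- Dynkin's formula. -/
theorem bchTerm_eq_logTerm (N : NilFiltration p Q) (hN : ∀ x, x ∈ N.E 0) {a b : Q}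
    (ha : a ∈ N.E 1) (hb : b ∈ N.E 1) {n : ℕ} (h0 : 0 < n) (hn : n < p) :
    bchTerm p n a b = logTerm p n a b := by
  have hmon : ∀ {c : Q}, c ∈ N.E 1 → (monomial 1 c : Q[X]) ∈ N.poly.E 1 := fun hc k => by
    rw [coeff_monomial]
    split_ifs
    exacts [hc, zero_mem _]
  -- Both sides of `commOp_tlog`, for `a X` and `b X`, are applied to `∂`. The left side becomes the
  -- Euler derivative of the logarithm, the right side a sum of left-normed brackets. The powers of
  -- `X` keep track of degrees.
  have key := congrArg (fun f => f.unop (0, 1)) (commOp_tlog N hN (hmon ha) (hmon hb))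
  simp only [unop_commOp_partial] at key
  rw [NilFiltration.tlog_texp_mul_texp (eulerFiltration N hN).endo.op (commOp_mem N hN (hmon ha))
    (commOp_mem N hN (hmon hb)), N.poly.tlog_texp_mul_texp (hmon ha) (hmon hb)] at key
  have h1 : eulerDer (∑ n ∈ Finset.Icc 1 (p - 1), logTerm p n (monomial 1 a : Q[X]) (monomial 1 b))
      = ∑ n ∈ Finset.Icc 1 (p - 1), monomial n ((n : ℤ_[p]) • logTerm p n a b) := by
    rw [eulerDer, derivative_sum, Finset.mul_sum]
    exact Finset.sum_congr rfl fun k _ => by rw [← eulerDer_monomial, ← logTerm_monomial_one]; rfl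
  have h2 : ∀ k ∈ Finset.Icc 1 (p - 1),
      (logTerm p k (commOp p (monomial 1 a : Q[X])) (commOp p (monomial 1 b))).unop (0, 1) =
        (monomial k ((k : ℤ_[p]) • bchTerm p k a b), 0) := by
    intro k hk
    rw [Finset.mem_Icc] at hk
    have : ((monomial k ((k : ℤ_[p]) • bchTerm p k a b), 0) : Q[X] × Q[X]) =
        LinearMap.inl ℤ_[p] Q[X] Q[X] (((monomial k).restrictScalars ℤ_[p])
          ((k : ℤ_[p]) • bchTerm p k a b)) := rfl
    rw [this]
    simp only [logTerm, bchTerm, map_sum, Finset.unop_sum, LinearMap.sum_apply, Finset.smul_sum, unop_smul,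
      LinearMap.smul_apply, map_smul]
    refine Finset.sum_congr rfl fun m hm => Finset.sum_congr rfl fun e he => ?_
    rw [Finset.mem_filter] at he
    -- The factor `n` cancels the `1 / n` by which Dynkin's coefficients differ from those of
    -- `logTerm`.
    rw [← List.map_dynkinWord_eq (commOp p), unop_prod_map_commOp_partial, smul_smul,
      mul_left_comm, mul_assoc k m, inverse_natCast_mul (by omega) (by omega),
      ← List.map_dynkinWord_eq (monomial 1), leftBracket_map_monomial_one, length_dynkinWord,
      he.2.2]
    · rfl
    · intro h
      have := congrArg List.length h
      rw [length_dynkinWord, he.2.2] at this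
      simp at this; omega
    · intro u hu
      rcases mem_dynkinWord hu with rfl | rfl <;> simp [eulerDer_monomial p]
  rw [h1, Finset.unop_sum, LinearMap.sum_apply, Finset.sum_congr rfl h2] at key
  -- Comparing coefficients of `X ^ n` gives the identity multiplied by `n`, which is a unit.
  have h3 := congrArg (fun x => x.1.coeff n) key
  simp only [Prod.fst_sum, finsetSum_coeff, coeff_monomial, Finset.sum_ite_eq', Finset.mem_Icc]
    at h3
  rw [if_pos (by omega), if_pos (by omega)] at h3
  exact ((PadicInt.isUnit_natCast_of_lt p h0 hn).smul_left_cancel.mp h3).symm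

theorem bch_eq_tlog (N : NilFiltration p Q) (hN : ∀ x, x ∈ N.E 0) {a b : Q}
    (ha : a ∈ N.E 1) (hb : b ∈ N.E 1) : bch p a b = tlog p (texp p a * texp p b - 1) := by
  rw [N.tlog_texp_mul_texp ha hb, bch]
  refine Finset.sum_congr rfl fun n hn => ?_
  rw [Finset.mem_Icc] at hn
  exact bchTerm_eq_logTerm N hN ha hb (by omega) (by omega)

theorem texp_bch (N : NilFiltration p Q) (hN : ∀ x, x ∈ N.E 0) {a b : Q}
    (ha : a ∈ N.E 1) (hb : b ∈ N.E 1) : texp p (bch p a b) = texp p a * texp p b := by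
  rw [bch_eq_tlog N hN ha hb]
  exact N.texp_tlog_sub_one (N.mul_sub_one_mem (N.texp_sub_one_mem ha) (N.texp_sub_one_mem hb))

end Dynkin

/-! ### The Baker-Campbell-Hausdorff law on a nilpotent Lie algebra -/

/-- The algebra of elements of filtration `≥ 0`. -/
def NilFiltration.subalgebra {p : ℕ} [Fact p.Prime] {Q : Type*} [Ring Q] [Algebra ℤ_[p] Q]
    (N : NilFiltration p Q) : Subalgebra ℤ_[p] Q where
  carrier := N.E 0
  mul_mem' ha hb := N.mul_mem ha hb
  add_mem' ha hb := add_mem ha hb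
  algebraMap_mem' r := by
    rw [Algebra.algebraMap_eq_smul_one]
    exact Submodule.smul_mem _ _ N.one_mem

/-- The induced filtration on the elements of filtration `≥ 0`. -/
def NilFiltration.restrict {p : ℕ} [Fact p.Prime] {Q : Type*} [Ring Q] [Algebra ℤ_[p] Q]
    (N : NilFiltration p Q) : NilFiltration p N.subalgebra where
  E i := (N.E i).comap N.subalgebra.val.toLinearMap
  anti _ _ hij _ hf := N.anti hij hf
  mul_mem ha hb := N.mul_mem ha hb
  one_mem := N.one_mem
  eq_zero ha := Subtype.ext (N.eq_zero ha)

instance (p : ℕ) [Fact p.Prime] {Q : Type*} [Ring Q] [Algebra ℤ_[p] Q]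
    (N : NilFiltration p Q) : LieRing N.subalgebra := LieRing.ofAssociativeRing

instance (p : ℕ) [Fact p.Prime] {Q : Type*} [Ring Q] [Algebra ℤ_[p] Q]
    (N : NilFiltration p Q) : LieAlgebra ℤ_[p] N.subalgebra := LieAlgebra.ofAssociativeAlgebra

/-- A filtration `L = C 1 ⊇ C 2 ⊇ ⋯ ⊇ C p = 0` with `[C i, C j] ⊆ C (i + j)`. -/
structure LieFiltration (p : ℕ) [Fact p.Prime] (L : Type*) [LieRing L] [LieAlgebra ℤ_[p] L] where
  /-- The pieces of the filtration. -/
  C : ℕ → Submodule ℤ_[p] L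
  anti : Antitone C
  mem_one : ∀ x, x ∈ C 1
  lie_mem : ∀ {i j : ℕ} {x y : L}, x ∈ C i → y ∈ C j → ⁅x, y⁆ ∈ C (i + j)
  eq_zero : ∀ {x}, x ∈ C p → x = 0

namespace LieFiltration

variable {p : ℕ} [Fact p.Prime] {L : Type*} [LieRing L] [LieAlgebra ℤ_[p] L]
  (Φ : LieFiltration p L)

/-- The induced filtration of `A ⊗ L`. -/
def baseChange (A : Type*) [CommRing A] [Algebra ℤ_[p] A] :
    LieFiltration p (A ⊗[ℤ_[p]] L) where
  C k := Submodule.span ℤ_[p] {w | ∃ a : A, ∃ x ∈ Φ.C k, a ⊗ₜ[ℤ_[p]] x = w}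
  anti i j hij := Submodule.span_mono fun _ ⟨a, x, hx, h⟩ => ⟨a, x, Φ.anti hij hx, h⟩
  mem_one w := by
    induction w with
    | zero => exact zero_mem _
    | tmul a x => exact Submodule.subset_span ⟨a, x, Φ.mem_one x, rfl⟩
    | add u v hu hv => exact add_mem hu hv
  lie_mem {i j x y} hx hy := by
    induction hx, hy using Submodule.span_induction₂ with
    | mem_mem _ _ h1 h2 =>
      obtain ⟨a, x, hx, rfl⟩ := h1
      obtain ⟨b, y, hy, rfl⟩ := h2
      exact Submodule.subset_span ⟨a * b, _, Φ.lie_mem hx hy, rfl⟩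
    | zero_left => simp
    | zero_right => simp
    | add_left _ _ _ _ _ _ h1 h2 => rw [add_lie]; exact add_mem h1 h2
    | add_right _ _ _ _ _ _ h1 h2 => rw [lie_add]; exact add_mem h1 h2
    | smul_left r _ _ _ _ h => rw [smul_lie]; exact Submodule.smul_mem _ r h
    | smul_right r _ _ _ _ h => rw [lie_smul]; exact Submodule.smul_mem _ r h
  eq_zero {w} hw := by
    induction hw using Submodule.span_induction with
    | mem _ h =>
      obtain ⟨a, x, hx, rfl⟩ := h
      rw [Φ.eq_zero hx, TensorProduct.tmul_zero]
    | zero => rfl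
    | add _ _ _ _ h1 h2 => rw [h1, h2, add_zero]
    | smul r _ _ h => rw [h, smul_zero]

/-- The image of a filtration under a surjective homomorphism. -/
def map {L' : Type*} [LieRing L'] [LieAlgebra ℤ_[p] L'] (f : L →ₗ⁅ℤ_[p]⁆ L')
    (hf : Function.Surjective f) : LieFiltration p L' where
  C k := (Φ.C k).map (f : L →ₗ[ℤ_[p]] L')
  anti i j hij := Submodule.map_mono (Φ.anti hij)
  mem_one y := by
    obtain ⟨x, rfl⟩ := hf y
    exact ⟨x, Φ.mem_one x, rfl⟩
  lie_mem := by
    rintro i j _ _ ⟨x, hx, rfl⟩ ⟨y, hy, rfl⟩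
    exact ⟨⁅x, y⁆, Φ.lie_mem hx hy, LieHom.map_lie f x y⟩
  eq_zero := by
    rintro _ ⟨x, hx, rfl⟩
    rw [Φ.eq_zero hx, map_zero]

end LieFiltration

/-! ### The adjoint representation extended by a derivation -/

section ExtendedAdjoint

variable {p : ℕ} [Fact p.Prime] {K : Type*} [LieRing K] [LieAlgebra ℤ_[p] K]

/-- The filtration of `K ⊕ ℤ_[p] ∂`. -/
def LieFiltration.extended (Φ : LieFiltration p K) : ModFiltration p (K × ℤ_[p]) where
  -- Only step `0` contains `∂`: an operator sends `∂` to `-δ u`, which lies in `K = C 1`.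
  F k := if k = 0 then ⊤ else (Φ.C k).prod ⊥
  anti i j hij := by
    rcases Nat.eq_zero_or_pos i with rfl | hi
    · exact le_top
    · simp only [hi.ne', (hi.trans_le hij).ne', if_false]
      exact Submodule.prod_mono (Φ.anti hij) le_rfl
  mem_zero _ := Submodule.mem_top
  eq_zero {x} hx := by
    rw [if_neg (Fact.out : p.Prime).ne_zero] at hx
    exact Prod.ext (Φ.eq_zero hx.1) hx.2

/-- The action of `u` on `K ⊕ ℤ_[p] ∂`, where `[∂, u] = δ u`. -/
def extendedAd (δ : K →ₗ[ℤ_[p]] K) (u : K) : Module.End ℤ_[p] (K × ℤ_[p]) where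
  toFun x := (⁅u, x.1⁆ - x.2 • δ u, 0)
  map_add' x y := by
    simp only [Prod.fst_add, Prod.snd_add, lie_add, add_smul, Prod.mk_add_mk, add_zero]
    congr 1; abel
  map_smul' c x := by
    simp only [Prod.smul_fst, Prod.smul_snd, lie_smul, smul_eq_mul, mul_smul, smul_sub,
      Prod.smul_mk, mul_zero, RingHom.id_apply]

variable (Φ : LieFiltration p K) (δ : K →ₗ[ℤ_[p]] K)

theorem LieFiltration.extendedAd_mem (u : K) : extendedAd δ u ∈ Φ.extended.endo.E 1 := by
  intro k m hm
  change _ ∈ (if k + 1 = 0 then ⊤ else (Φ.C (k + 1)).prod ⊥)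
  rw [if_neg k.succ_ne_zero]
  refine ⟨?_, rfl⟩
  rcases Nat.eq_zero_or_pos k with rfl | hk
  · exact Φ.mem_one _
  · change m ∈ (if k = 0 then ⊤ else (Φ.C k).prod ⊥) at hm
    rw [if_neg hk.ne'] at hm
    obtain ⟨h1, h2⟩ := hm
    have h2 : m.2 = 0 := h2
    change ⁅u, m.1⁆ - m.2 • δ u ∈ _
    rw [h2, zero_smul, sub_zero, add_comm]
    exact Φ.lie_mem (Φ.mem_one u) h1

variable (hδ : ∀ u v, δ ⁅u, v⁆ = ⁅δ u, v⁆ + ⁅u, δ v⁆)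

/-- The action on `K ⊕ ℤ_[p] ∂`, as a homomorphism of Lie algebras. -/
def LieFiltration.ad : K →ₗ⁅ℤ_[p]⁆ Φ.extended.endo.subalgebra where
  toFun u := ⟨extendedAd δ u, Φ.extended.endo.anti zero_le_one (Φ.extendedAd_mem δ u)⟩
  map_add' u v := Subtype.ext <| LinearMap.ext fun x => by
    change (⁅u + v, x.1⁆ - x.2 • δ (u + v), (0 : ℤ_[p])) =
      (⁅u, x.1⁆ - x.2 • δ u, 0) + (⁅v, x.1⁆ - x.2 • δ v, 0)
    simp only [add_lie, map_add, smul_add, Prod.mk_add_mk, add_zero]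
    congr 1; abel
  map_smul' c u := Subtype.ext <| LinearMap.ext fun x => by
    change (⁅c • u, x.1⁆ - x.2 • δ (c • u), (0 : ℤ_[p])) = c • (⁅u, x.1⁆ - x.2 • δ u, 0)
    simp only [smul_lie, map_smul, smul_comm x.2 c, ← smul_sub, Prod.smul_mk, smul_zero]
  map_lie' {u v} := Subtype.ext <| LinearMap.ext fun x => by
    change (⁅⁅u, v⁆, x.1⁆ - x.2 • δ ⁅u, v⁆, (0 : ℤ_[p])) =
      (⁅u, ⁅v, x.1⁆ - x.2 • δ v⁆ - (0 : ℤ_[p]) • δ u, 0) -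
        (⁅v, ⁅u, x.1⁆ - x.2 • δ u⁆ - (0 : ℤ_[p]) • δ v, 0)
    simp only [lie_sub, lie_smul, zero_smul, sub_zero, Prod.mk_sub_mk, hδ, lie_lie, smul_add]
    rw [← lie_skew (δ u) v]
    congr 1
    simp only [smul_neg]
    abel

theorem LieFiltration.ad_mem (u : K) : Φ.ad δ hδ u ∈ Φ.extended.endo.restrict.E 1 :=
  Φ.extendedAd_mem δ u

/-- A homomorphism of Lie algebras commutes with `∘`. The target is restricted to the operators of
filtration `≥ 0`, so that the associative result applies to it. -/
theorem LieFiltration.texp_ad_bch (u v : K) :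
    texp p (Φ.ad δ hδ (bch p u v)) = texp p (Φ.ad δ hδ u) * texp p (Φ.ad δ hδ v) := by
  rw [map_bch, texp_bch Φ.extended.endo.restrict (fun x => x.2) (Φ.ad_mem δ hδ u)
    (Φ.ad_mem δ hδ v)]

/-- The exponential is injective on filtration `≥ 1`, so the operators coincide, and their values at
`∂ = (0, 1)` are `-δ u` and `-δ v`. -/
theorem LieFiltration.eq_of_texp_ad_eq {u v : K}
    (h : texp p (Φ.ad δ hδ u) = texp p (Φ.ad δ hδ v)) : δ u = δ v := by
  have h1 := Φ.extended.endo.restrict.texp_injective (Φ.ad_mem δ hδ u) (Φ.ad_mem δ hδ v) h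
  have h2 : extendedAd δ u (0, 1) = extendedAd δ v (0, 1) :=
    congrArg (fun f => f.1 (0, 1)) h1
  simpa [extendedAd] using h2

end ExtendedAdjoint

/-! ### Polynomials with coefficients in a Lie algebra and the group law -/

section PolynomialLie

open Polynomial TensorProduct

/-- The bracket of `A ⊗ L`, as part of its structure of Lie ring. -/
abbrev tensorBracket (R A L : Type*) [CommRing R] [CommRing A] [Algebra R A] [LieRing L]
    [LieAlgebra R L] : Bracket (A ⊗[R] L) (A ⊗[R] L) := LieRing.toBracket

attribute [local instance] tensorBracket

theorem tensor_lie_tmul {R A L : Type*} [CommRing R] [CommRing A] [Algebra R A] [LieRing L]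
    [LieAlgebra R L] (a b : A) (x y : L) :
    ⁅a ⊗ₜ[R] x, b ⊗ₜ[R] y⁆ = (a * b) ⊗ₜ[R] ⁅x, y⁆ := rfl

section

variable {R A L : Type*} [CommRing R] [CommRing A] [Algebra R A] [LieRing L] [LieAlgebra R L]
  (u u' v v' : A ⊗[R] L)

theorem tensor_zero_lie : ⁅(0 : A ⊗[R] L), v⁆ = 0 := zero_lie v

theorem tensor_lie_zero : ⁅u, (0 : A ⊗[R] L)⁆ = 0 := lie_zero u

theorem tensor_add_lie : ⁅u + u', v⁆ = ⁅u, v⁆ + ⁅u', v⁆ := add_lie u u' v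

theorem tensor_lie_add : ⁅u, v + v'⁆ = ⁅u, v⁆ + ⁅u, v'⁆ := lie_add u v v'

end

variable (p : ℕ) [Fact p.Prime] (L : Type*) [LieRing L] [LieAlgebra ℤ_[p] L]

/-- The coefficient of `X ^ n` of an element of `ℤ_[p][X] ⊗ L`. -/
def tensorCoeff (n : ℕ) : ℤ_[p][X] ⊗[ℤ_[p]] L →ₗ[ℤ_[p]] L :=
  (TensorProduct.lid ℤ_[p] L).toLinearMap ∘ₗ (lcoeff ℤ_[p] n).rTensor L

@[simp]
theorem tensorCoeff_tmul (n : ℕ) (f : ℤ_[p][X]) (x : L) :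
    tensorCoeff p L n (f ⊗ₜ x) = f.coeff n • x := by
  simp [tensorCoeff]

/-- The Euler derivation on `ℤ_[p][X] ⊗ L`. -/
def tensorEuler : ℤ_[p][X] ⊗[ℤ_[p]] L →ₗ[ℤ_[p]] ℤ_[p][X] ⊗[ℤ_[p]] L :=
  (LinearMap.mulLeft ℤ_[p] X ∘ₗ derivative).rTensor L

@[simp]
theorem tensorEuler_tmul (f : ℤ_[p][X]) (x : L) :
    tensorEuler p L (f ⊗ₜ x) = (X * derivative f) ⊗ₜ x := by
  simp [tensorEuler]

/-- Evaluation at `X = 1`. -/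
def tensorEval : ℤ_[p][X] ⊗[ℤ_[p]] L →ₗ⁅ℤ_[p]⁆ L where
  toLinearMap := (TensorProduct.lid ℤ_[p] L).toLinearMap ∘ₗ
    ((aeval (1 : ℤ_[p])).toLinearMap.rTensor L)
  map_lie' {u v} := by
    change ((TensorProduct.lid ℤ_[p] L).toLinearMap ∘ₗ
      ((aeval (1 : ℤ_[p])).toLinearMap.rTensor L)) ⁅u, v⁆ = _
    induction u with
    | zero => simp [tensor_zero_lie]
    | add u u' h h' => simp_all [tensor_add_lie]
    | tmul f x =>
      induction v with
      | zero => simp [tensor_lie_zero]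
      | add v v' h h' => simp_all [tensor_lie_add]
      | tmul g y => simp [mul_smul, smul_comm (eval 1 f)]

@[simp]
theorem tensorEval_tmul (f : ℤ_[p][X]) (x : L) :
    tensorEval p L (f ⊗ₜ x) = f.eval 1 • x := by
  change ((TensorProduct.lid ℤ_[p] L).toLinearMap ∘ₗ
      ((aeval (1 : ℤ_[p])).toLinearMap.rTensor L)) _ = _
  simp [coe_aeval_eq_eval]

variable {L}

theorem tensorCoeff_tensorEuler (n : ℕ) (w : ℤ_[p][X] ⊗[ℤ_[p]] L) :
    tensorCoeff p L n (tensorEuler p L w) = (n : ℤ_[p]) • tensorCoeff p L n w := by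
  induction w with
  | zero => simp
  | add u v h h' => simp [h, h']
  | tmul f x =>
    rw [tensorEuler_tmul, tensorCoeff_tmul, tensorCoeff_tmul, smul_smul]
    congr 1
    cases n with
    | zero => simp
    | succ n => rw [coeff_X_mul, coeff_derivative]; push_cast; ring

theorem tensorEuler_lie (u v : ℤ_[p][X] ⊗[ℤ_[p]] L) :
    tensorEuler p L ⁅u, v⁆ = ⁅tensorEuler p L u, v⁆ + ⁅u, tensorEuler p L v⁆ := by
  induction u with
  | zero => simp [tensor_zero_lie]
  | add u u' h h' => simp only [tensor_add_lie, map_add, h, h']; abel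
  | tmul f x =>
    induction v with
    | zero => simp [tensor_lie_zero]
    | add v v' h h' => simp only [tensor_lie_add, map_add, h, h']; abel
    | tmul g y =>
      simp only [tensor_lie_tmul, tensorEuler_tmul, ← add_tmul]
      congr 1
      rw [derivative_mul]; ring

theorem tensorCoeff_lie (n : ℕ) (u v : ℤ_[p][X] ⊗[ℤ_[p]] L) :
    tensorCoeff p L n ⁅u, v⁆ = ∑ x ∈ Finset.HasAntidiagonal.antidiagonal n,
      ⁅tensorCoeff p L x.1 u, tensorCoeff p L x.2 v⁆ := by
  induction u with
  | zero => simp [tensor_zero_lie]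
  | add u u' h h' => simp [tensor_add_lie, map_add, h, h', Finset.sum_add_distrib]
  | tmul f x =>
    induction v with
    | zero => simp [tensor_lie_zero]
    | add v v' h h' => simp [tensor_lie_add, map_add, h, h', Finset.sum_add_distrib]
    | tmul g y =>
      simp only [tensor_lie_tmul, tensorCoeff_tmul, coeff_mul,
        Finset.sum_smul, smul_lie, lie_smul, smul_smul, mul_comm]

theorem tensorEval_eq_zero {w : ℤ_[p][X] ⊗[ℤ_[p]] L} (h : ∀ n, tensorCoeff p L n w = 0) :
    tensorEval p L w = 0 := by
  -- The value at `X = 1` is the sum of the coefficients. The bound is stated for all `K ≥ N`, so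
  -- that two bounds can be merged when adding tensors.
  obtain ⟨N, hN⟩ : ∃ N, ∀ K ≥ N, tensorEval p L w =
      ∑ n ∈ Finset.range K, tensorCoeff p L n w := by
    clear h
    induction w with
    | zero => exact ⟨0, by simp⟩
    | add u v hu hv =>
      obtain ⟨N, hN⟩ := hu
      obtain ⟨N', hN'⟩ := hv
      refine ⟨max N N', fun K hK => ?_⟩
      simp [map_add, Finset.sum_add_distrib, ← hN K (by omega), ← hN' K (by omega)]
    | tmul f x =>
      refine ⟨f.natDegree + 1, fun K hK => ?_⟩
      simp only [tensorEval_tmul, tensorCoeff_tmul]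
      rw [← Finset.sum_smul, eval_eq_sum_range' (n := K) (by omega)]
      simp
  rw [hN N le_rfl]
  exact Finset.sum_eq_zero fun n _ => h n

variable {p}
variable (Φ : LieFiltration p L)

/-- The Rees algebra `⨁_{n > 0} C n X ^ n`. -/
def LieFiltration.rees : LieSubalgebra ℤ_[p] (ℤ_[p][X] ⊗[ℤ_[p]] L) where
  -- The constant coefficient has to vanish because the Euler derivation does not see it.
  carrier := {w | tensorCoeff p L 0 w = 0 ∧ ∀ n, tensorCoeff p L n w ∈ Φ.C n}
  zero_mem' := by simp
  add_mem' := by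
    rintro u v ⟨hu, hu'⟩ ⟨hv, hv'⟩
    exact ⟨by rw [map_add, hu, hv, add_zero], fun n => by
      rw [map_add]; exact add_mem (hu' n) (hv' n)⟩
  smul_mem' := by
    rintro c u ⟨hu, hu'⟩
    exact ⟨by rw [map_smul, hu, smul_zero], fun n => by
      rw [map_smul]; exact Submodule.smul_mem _ _ (hu' n)⟩
  lie_mem' := by
    rintro u v ⟨hu, hu'⟩ ⟨hv, hv'⟩
    refine ⟨?_, fun n => ?_⟩
    · rw [tensorCoeff_lie]; simp [hu]
    · rw [tensorCoeff_lie]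
      refine Submodule.sum_mem _ fun x hx => ?_
      rw [← Finset.HasAntidiagonal.mem_antidiagonal.mp hx]
      exact Φ.lie_mem (hu' _) (hv' _)

theorem LieFiltration.X_tmul_mem_rees (x : L) : (X : ℤ_[p][X]) ⊗ₜ x ∈ Φ.rees := by
  refine ⟨by simp, fun n => ?_⟩
  rw [tensorCoeff_tmul, coeff_X]
  split_ifs with h
  · rw [← h]; exact Submodule.smul_mem _ _ (Φ.mem_one x)
  · simp

theorem LieSubalgebra.bch_mem (S : LieSubalgebra ℤ_[p] L) {x y : L} (hx : x ∈ S) (hy : y ∈ S) :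
    bch p x y ∈ S := by
  have := map_bch S.incl (⟨x, hx⟩ : S) ⟨y, hy⟩
  simp only [LieSubalgebra.coe_incl] at this
  rw [← this]
  exact Subtype.property _

/-- The Euler derivation multiplies the coefficient of `X ^ n` by `n`, a unit for `0 < n < p`; in
the Rees algebra the other coefficients are zero. -/
theorem LieFiltration.tensorEval_eq_of_tensorEuler_eq {u v : ℤ_[p][X] ⊗[ℤ_[p]] L}
    (hu : u ∈ Φ.rees) (hv : v ∈ Φ.rees) (h : tensorEuler p L u = tensorEuler p L v) :
    tensorEval p L u = tensorEval p L v := by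
  rw [← sub_eq_zero, ← map_sub]
  obtain ⟨h0, h1⟩ := sub_mem hu hv
  refine tensorEval_eq_zero p fun n => ?_
  rcases Nat.eq_zero_or_pos n with rfl | hn
  · exact h0
  · rcases lt_or_ge n p with hnp | hnp
    · have := tensorCoeff_tensorEuler p n (u - v)
      rw [map_sub, h, sub_self, map_zero] at this
      exact (PadicInt.isUnit_natCast_of_lt p hn hnp).smul_eq_zero.mp this.symm
    · exact Φ.eq_zero (Φ.anti hnp (h1 n))

/-- On a Lie algebra of nilpotency class `< p`, the truncated Baker-Campbell-Hausdorff law is a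
group law. -/
theorem LieFiltration.isBCHGroupLaw (Φ : LieFiltration p L) : IsBCHGroupLaw p L := by
  set Ψ := Φ.baseChange ℤ_[p][X] with hΨ
  set ad := Ψ.ad (tensorEuler p L) (tensorEuler_lie p) with had
  have had_bch : ∀ u v, texp p (ad (bch p u v)) = texp p (ad u) * texp p (ad v) :=
    Ψ.texp_ad_bch (tensorEuler p L) (tensorEuler_lie p)
  -- An identity in `L` is lifted to the Rees algebra by `x ↦ X ⊗ x`, checked there after applying
  -- `exp ∘ ad`, where `∘` becomes a product of operators, and brought back by `X = 1`.
  have key : ∀ {u v : ℤ_[p][X] ⊗[ℤ_[p]] L}, u ∈ Φ.rees → v ∈ Φ.rees →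
      texp p (ad u) = texp p (ad v) → tensorEval p L u = tensorEval p L v :=
    fun hu hv h => Φ.tensorEval_eq_of_tensorEuler_eq hu hv
      (Ψ.eq_of_texp_ad_eq (tensorEuler p L) (tensorEuler_lie p) h)
  have hm := Φ.X_tmul_mem_rees
  have ev : ∀ x : L, tensorEval p L ((X : ℤ_[p][X]) ⊗ₜ x) = x := fun x => by simp
  have hb : ∀ {u v : ℤ_[p][X] ⊗[ℤ_[p]] L}, u ∈ Φ.rees → v ∈ Φ.rees → bch p u v ∈ Φ.rees :=
    fun hu hv => LieSubalgebra.bch_mem _ hu hv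
  refine ⟨fun x y z => ?_, fun x => ?_, fun x => ?_, fun x => ?_⟩
  · have := key (hb (hb (hm x) (hm y)) (hm z)) (hb (hm x) (hb (hm y) (hm z)))
      (by simp only [had_bch, mul_assoc])
    simpa only [map_bch, ev] using this
  · have := key (hb (zero_mem _) (hm x)) (hm x)
      (by rw [had_bch, map_zero, texp_zero, one_mul])
    simpa only [map_bch, ev, map_zero] using this
  · have := key (hb (hm x) (zero_mem _)) (hm x)
      (by rw [had_bch, map_zero, texp_zero, mul_one])
    simpa only [map_bch, ev, map_zero] using this
  · have := key (hb (neg_mem (hm x)) (hm x)) (zero_mem _)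
      (by rw [had_bch, map_neg, map_zero, texp_zero,
        Ψ.extended.endo.restrict.texp_neg_mul_texp (Ψ.ad_mem _ _ _)])
    simpa only [map_bch, ev, map_zero, map_neg] using this

end PolynomialLie

/-! ### Central extensions of Lie algebras -/

section CommutingBCH

variable {p : ℕ} [Fact p.Prime] {L : Type*} [LieRing L] [LieAlgebra ℤ_[p] L]

theorem foldl_lie_zero (l : List L) : l.foldl (fun u v => ⁅u, v⁆) 0 = 0 := by
  induction l with
  | nil => rfl
  | cons b l ih => simpa using ih

/-- A word with at least two letters has an innermost bracket of two letters among `x` and `y`,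
which vanishes. -/
theorem leftBracket_eq_zero_of_lie_eq_zero {x y : L} (h : ⁅x, y⁆ = 0) {l : List L}
    (hl : ∀ z ∈ l, z = x ∨ z = y) (hlen : l.length ≠ 1) : leftBracket l = 0 := by
  match l, hlen with
  | [], _ => rfl
  | [_], hlen => exact absurd rfl hlen
  | a :: b :: l, _ =>
    have hab : ⁅a, b⁆ = 0 := by
      have h' : ⁅y, x⁆ = 0 := by rw [← lie_skew, h, neg_zero]
      rcases hl a (by simp) with rfl | rfl <;> rcases hl b (by simp) with rfl | rfl <;>
        first | exact lie_self _ | assumption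
    rw [leftBracket, List.foldl_cons, hab, foldl_lie_zero]

theorem bchTerm_one (x y : L) : bchTerm p 1 x y = x + y := by
  have hS : (Finset.univ.filter fun e : Fin 1 → Fin 2 × Fin 2 =>
      (∀ i, 0 < ((e i).1 : ℕ) + ((e i).2 : ℕ)) ∧ ∑ i, (((e i).1 : ℕ) + ((e i).2 : ℕ)) = 1) =
      {fun _ => (1, 0), fun _ => (0, 1)} := by decide
  rw [bchTerm, Finset.Icc_self, Finset.sum_singleton, hS, Finset.sum_pair (by decide)]
  simp [dynkinWord, leftBracket]

theorem bch_eq_add_of_lie_eq_zero {x y : L} (h : ⁅x, y⁆ = 0) : bch p x y = x + y := by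
  rw [bch, Finset.sum_eq_single 1, bchTerm_one]
  · intro n hn hn1
    refine Finset.sum_eq_zero fun m _ => Finset.sum_eq_zero fun e he => ?_
    rw [Finset.mem_filter] at he
    rw [leftBracket_eq_zero_of_lie_eq_zero h (fun z hz => mem_dynkinWord hz), smul_zero]
    rwa [length_dynkinWord, he.2.2]
  · intro h1
    have := (Fact.out : p.Prime).two_le
    simp at h1; omega

/-- Adding a central element is the same as composing with it under `∘`, so associativity allows the
central factors to be collected. -/
theorem IsBCHGroupLaw.bch_add_central (hL : IsBCHGroupLaw p L) (x y : L) {c d : L}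
    (hc : ∀ x : L, ⁅x, c⁆ = 0) (hd : ∀ x : L, ⁅x, d⁆ = 0) :
    bch p (x + c) (y + d) = bch p x y + (c + d) := by
  have hcd : ∀ x : L, ⁅x, c + d⁆ = 0 := fun x => by rw [lie_add, hc, hd, add_zero]
  have hcd' : ∀ x : L, ⁅c + d, x⁆ = 0 := fun x => by rw [← lie_skew, hcd, neg_zero]
  have hdy : ⁅d, y⁆ = 0 := by rw [← lie_skew, hd, neg_zero]
  rw [← bch_eq_add_of_lie_eq_zero (p := p) (hc x), add_comm y d,
    ← bch_eq_add_of_lie_eq_zero (p := p) hdy, hL.assoc,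
    ← hL.assoc c, bch_eq_add_of_lie_eq_zero (hd c), bch_eq_add_of_lie_eq_zero (hcd' y),
    add_comm (c + d), ← bch_eq_add_of_lie_eq_zero (p := p) (hcd y), ← hL.assoc,
    bch_eq_add_of_lie_eq_zero (hcd _)]

/-- `q` is surjective, with kernel the central submodule generated by `z`, of order `p`. -/
structure IsCentralExt {p : ℕ} [Fact p.Prime] {𝔤 𝔥 : Type*} [LieRing 𝔤] [LieAlgebra ℤ_[p] 𝔤]
    [LieRing 𝔥] [LieAlgebra ℤ_[p] 𝔥] (q : 𝔤 →ₗ⁅ℤ_[p]⁆ 𝔥) (z : 𝔤) : Prop where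
  surj : Function.Surjective q
  ne_zero : z ≠ 0
  smul_eq_zero : (p : ℤ_[p]) • z = 0
  lie_eq_zero : ∀ x : 𝔤, ⁅x, z⁆ = 0
  exact : ∀ x, q x = 0 → ∃ c : ℤ_[p], c • z = x
  map_eq_zero : q z = 0

/-- The order of `M` kills `x`, and it is a unit of `ℤ_[p]` times a power of `p`. -/
theorem exists_pow_smul_eq_zero {M : Type*} [AddCommGroup M] [Module ℤ_[p] M] [Finite M] (x : M) :
    ∃ n, ((p : ℤ_[p]) ^ n) • x = 0 := by
  have hk : (Nat.card M : ℤ_[p]) • x = 0 := by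
    rw [Nat.cast_smul_eq_nsmul]; exact card_nsmul_eq_zero'
  have h0 : (Nat.card M : ℤ_[p]) ≠ 0 := by exact_mod_cast Nat.card_pos.ne'
  refine ⟨(Nat.card M : ℤ_[p]).valuation, ?_⟩
  have := PadicInt.unitCoeff_spec h0
  rw [this, mul_smul] at hk
  exact (PadicInt.unitCoeff h0).isUnit.smul_eq_zero.mp hk

/-- The projection to a quotient by an ideal. -/
def lieQuotientMk {L : Type*} [LieRing L] [LieAlgebra ℤ_[p] L] (I : LieIdeal ℤ_[p] L) :
    L →ₗ⁅ℤ_[p]⁆ L ⧸ I where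
  toLinearMap := (LieSubmodule.Quotient.mk' I : L →ₗ[ℤ_[p]] L ⧸ I)
  map_lie' := rfl

/-- A nonzero finite nilpotent Lie algebra is a central extension by a group of order `p`. -/
theorem LieFiltration.exists_isCentralExt {𝔤 : Type*} [LieRing 𝔤] [LieAlgebra ℤ_[p] 𝔤] [Finite 𝔤]
    [Nontrivial 𝔤] (Φ : LieFiltration p 𝔤) :
    ∃ (I : LieIdeal ℤ_[p] 𝔤) (z : 𝔤), IsCentralExt (lieQuotientMk I) z := by
  classical
  -- The last nonzero step of the filtration is central; a nonzero element of it is then scaled by a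
  -- power of `p` until `p` kills it.
  have hex : ∃ i, ∀ x ∈ Φ.C i, x = 0 := ⟨p, fun x hx => Φ.eq_zero hx⟩
  obtain ⟨x, hx, hx0⟩ : ∃ x : 𝔤, (∀ y : 𝔤, ⁅y, x⁆ = 0) ∧ x ≠ 0 := by
    obtain ⟨w, hw⟩ := exists_ne (0 : 𝔤)
    have h1 : Nat.find hex ≠ 0 := fun h =>
      hw (Nat.find_spec hex w (h ▸ Φ.anti zero_le_one (Φ.mem_one w)))
    obtain ⟨k, hk⟩ := Nat.exists_eq_succ_of_ne_zero h1
    have h2 := Nat.find_min hex (m := k) (by omega)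
    push Not at h2
    obtain ⟨x, hx, hx0⟩ := h2
    refine ⟨x, fun y => Nat.find_spec hex _ ?_, hx0⟩
    rw [hk, Nat.succ_eq_add_one, add_comm]
    exact Φ.lie_mem (Φ.mem_one y) hx
  have hn := exists_pow_smul_eq_zero (p := p) x
  have hn0 : Nat.find hn ≠ 0 := fun h => hx0 (by simpa [h] using Nat.find_spec hn)
  obtain ⟨n, hn'⟩ := Nat.exists_eq_succ_of_ne_zero hn0
  have hz : ∀ y : 𝔤, ⁅y, ((p : ℤ_[p]) ^ n) • x⁆ = 0 := fun y => by rw [lie_smul, hx, smul_zero]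
  let I : LieIdeal ℤ_[p] 𝔤 :=
    { Submodule.span ℤ_[p] {((p : ℤ_[p]) ^ n) • x} with
      lie_mem := by
        intro y m hm
        obtain ⟨c, rfl⟩ := Submodule.mem_span_singleton.mp hm
        rw [lie_smul, hz, smul_zero]
        exact zero_mem (Submodule.span ℤ_[p] {((p : ℤ_[p]) ^ n) • x}) }
  refine ⟨I, ((p : ℤ_[p]) ^ n) • x, ?_, Nat.find_min hn (by omega), ?_, hz, ?_, ?_⟩
  · exact LieSubmodule.Quotient.surjective_mk' I
  · have := Nat.find_spec hn
    rw [hn', Nat.succ_eq_add_one, pow_succ'] at this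
    rwa [smul_smul]
  · intro y hy
    exact Submodule.mem_span_singleton.mp ((LieSubmodule.Quotient.mk_eq_zero' (N := I)).mp hy)
  · exact (LieSubmodule.Quotient.mk_eq_zero' (N := I)).mpr (Submodule.mem_span_singleton_self _)

/-- Induction along central extensions. -/
theorem finite_lie_induction
    (P : ∀ (𝔤 : Type u) [LieRing 𝔤] [LieAlgebra ℤ_[p] 𝔤], Prop)
    (h0 : ∀ (𝔤 : Type u) [LieRing 𝔤] [LieAlgebra ℤ_[p] 𝔤] [Subsingleton 𝔤], P 𝔤)
    (h1 : ∀ (𝔤 𝔥 : Type u) [LieRing 𝔤] [LieAlgebra ℤ_[p] 𝔤] [LieRing 𝔥] [LieAlgebra ℤ_[p] 𝔥]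
      [Finite 𝔤] (_ : LieFiltration p 𝔤)
      (q : 𝔤 →ₗ⁅ℤ_[p]⁆ 𝔥) (z : 𝔤), IsCentralExt q z → P 𝔥 → P 𝔤)
    (𝔤 : Type u) [LieRing 𝔤] [LieAlgebra ℤ_[p] 𝔤] [Finite 𝔤] (Φ : LieFiltration p 𝔤) : P 𝔤 := by
  induction hn : Nat.card 𝔤 using Nat.strong_induction_on generalizing 𝔤 with
  | _ n ih =>
    rcases subsingleton_or_nontrivial 𝔤 with _ | _
    · exact h0 𝔤
    · obtain ⟨I, z, hI⟩ := Φ.exists_isCentralExt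
      have hfin : Finite (𝔤 ⧸ I) := Finite.of_surjective _ hI.surj
      refine h1 𝔤 (𝔤 ⧸ I) Φ _ z hI (ih _ ?_ (𝔤 ⧸ I) (Φ.map _ hI.surj) rfl)
      rw [← hn]
      -- Equal cardinalities would make the projection injective, although it kills `z ≠ 0`.
      refine (Nat.card_le_card_of_surjective _ hI.surj).lt_of_ne fun hcard => hI.ne_zero ?_
      have hbij := (Nat.bijective_iff_surjective_and_card (lieQuotientMk I)).mpr ⟨hI.surj, hcard.symm⟩
      exact hbij.1 (by rw [hI.map_eq_zero, map_zero])

end CommutingBCH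

/-! ### Witt vectors over perfect fields -/

section WittTensor

open WittVector

variable {p : ℕ} [Fact p.Prime] {R : Type*} [CommRing R] [CharP R p]

/-- Subtracting the Teichmüller lift leaves a Verschiebung. As Frobenius is bijective on `W(R)` and
`V F = p`, this is a multiple of `p`. -/
theorem WittVector.exists_eq_teichmuller_add [PerfectRing R p] (ω : WittVector p R) :
    ∃ y : WittVector p R, ω = teichmuller p (ω.coeff 0) + y * p := by
  have h0 : (ω - teichmuller p (ω.coeff 0)).coeff 0 = 0 := by
    have := add_coeff_zero (ω - teichmuller p (ω.coeff 0)) (teichmuller p (ω.coeff 0))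
    rwa [sub_add_cancel, teichmuller_coeff_zero, right_eq_add] at this
  obtain ⟨y, hy⟩ := (frobenius_bijective p R).2 ((ω - teichmuller p (ω.coeff 0)).shift 1)
  refine ⟨y, ?_⟩
  rw [← verschiebung_frobenius, hy]
  have := eq_iterate_verschiebung (x := ω - teichmuller p (ω.coeff 0)) (n := 1) (by simpa using h0)
  rw [Function.iterate_one] at this
  rw [← this, add_sub_cancel]

theorem WittVector.natCast_smul (n : ℕ) (ω : WittVector p R) : (n : ℤ_[p]) • ω = ω * n := by
  rw [Algebra.smul_def, map_natCast, mul_comm]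

/-- A nonzero scalar is a unit times a power of `p`, and `p ≠ 0` in the domain `W(R)`.
Torsion-freeness makes `W(R)` flat over `ℤ_[p]`, which `teichTensor_injective` uses. -/
instance [IsDomain R] : Module.IsTorsionFree ℤ_[p] (WittVector p R) := by
  have hinj : Function.Injective (algebraMap ℤ_[p] (WittVector p R)) := by
    rw [injective_iff_map_eq_zero]
    intro c hc
    by_contra hc0
    rw [PadicInt.unitCoeff_spec hc0, map_mul, map_pow, map_natCast] at hc
    rcases mul_eq_zero.mp hc with h | h
    · exact ((PadicInt.unitCoeff hc0).isUnit.map (algebraMap ℤ_[p] (WittVector p R))).ne_zero h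
    · exact pow_ne_zero _ (p_nonzero p R) h
  have := (faithfulSMul_iff_algebraMap_injective ℤ_[p] (WittVector p R)).mpr hinj
  infer_instance

variable {M M' : Type*} [AddCommGroup M] [Module ℤ_[p] M] [AddCommGroup M'] [Module ℤ_[p] M']

/-- The map `r ↦ [r] ⊗ z`. -/
def teichTensor (R : Type*) [CommRing R] [CharP R p] (z : M) (r : R) :
    WittVector p R ⊗[ℤ_[p]] M := teichmuller p r ⊗ₜ z

theorem teichTensor_zero (z : M) : teichTensor R z 0 = 0 := by
  rw [teichTensor, teichmuller_zero, TensorProduct.zero_tmul]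

section

variable [PerfectRing R p] {z : M}

/-- Modulo `p` a Witt vector is the Teichmüller lift of its coefficient `0`, and `p` kills `z`. This
is also why `r ↦ [r] ⊗ z` is additive, although Teichmüller lifts are not. -/
theorem tmul_eq_teichTensor (hz : (p : ℤ_[p]) • z = 0) (ω : WittVector p R) :
    ω ⊗ₜ[ℤ_[p]] z = teichTensor R z (ω.coeff 0) := by
  obtain ⟨y, hy⟩ := exists_eq_teichmuller_add ω
  nth_rewrite 1 [hy]
  rw [TensorProduct.add_tmul, ← natCast_smul, TensorProduct.smul_tmul, hz, TensorProduct.tmul_zero,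
    add_zero, teichTensor]

theorem teichTensor_add (hz : (p : ℤ_[p]) • z = 0) (r s : R) :
    teichTensor R z (r + s) = teichTensor R z r + teichTensor R z s := by
  have h : (teichmuller p r + teichmuller p s).coeff 0 = r + s := by
    rw [add_coeff_zero, teichmuller_coeff_zero, teichmuller_coeff_zero]
  change _ = teichmuller p r ⊗ₜ z + teichmuller p s ⊗ₜ z
  rw [← TensorProduct.add_tmul, tmul_eq_teichTensor hz, h]

theorem teichTensor_neg (hz : (p : ℤ_[p]) • z = 0) (r : R) :
    teichTensor R z (-r) = -teichTensor R z r := by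
  rw [eq_neg_iff_add_eq_zero, ← teichTensor_add hz, neg_add_cancel, teichTensor_zero]

/-- The element `z` embeds `ℤ_[p] ⧸ (p)` in `M`, and flatness preserves this. So `[r] ⊗ z = 0` puts
`[r]` in `p W(R)`, whose elements have coefficient `0` equal to zero. -/
theorem teichTensor_injective [IsDomain R] (hz : (p : ℤ_[p]) • z = 0) (hz0 : z ≠ 0) :
    Function.Injective (teichTensor R z) := by
  suffices h : ∀ r : R, teichTensor R z r = 0 → r = 0 by
    intro r s hrs
    rw [← sub_eq_zero]
    apply h
    rw [sub_eq_add_neg, teichTensor_add hz, teichTensor_neg hz, hrs, add_neg_cancel]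
  intro r hr
  set I : Ideal ℤ_[p] := Ideal.span {(p : ℤ_[p])} with hI
  let f : (ℤ_[p] ⧸ I) →ₗ[ℤ_[p]] M := Submodule.liftQ I (LinearMap.toSpanSingleton ℤ_[p] M z) (by
    rw [hI, Ideal.span, Submodule.span_singleton_le_iff_mem, LinearMap.mem_ker]
    simpa using hz)
  have hf : Function.Injective f := by
    rw [← LinearMap.ker_eq_bot]
    apply Submodule.ker_liftQ_eq_bot
    intro c hc
    rw [LinearMap.mem_ker, LinearMap.toSpanSingleton_apply] at hc
    by_contra hcI
    rw [hI, ← PadicInt.maximalIdeal_eq_span_p, IsLocalRing.mem_maximalIdeal, mem_nonunits_iff,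
      not_not] at hcI
    exact hz0 (hcI.smul_eq_zero.mp hc)
  have h1 := Module.Flat.lTensor_preserves_injective_linearMap (M := WittVector p R) f hf
  have h2 : (teichmuller p r) ⊗ₜ[ℤ_[p]] (Submodule.Quotient.mk (1 : ℤ_[p]) : ℤ_[p] ⧸ I) = 0 := by
    apply h1
    rw [map_zero, LinearMap.lTensor_tmul, ← hr, teichTensor]
    congr 1
    change f (Submodule.Quotient.mk 1) = z
    rw [Submodule.liftQ_apply, LinearMap.toSpanSingleton_apply, one_smul]
  have h4 : teichmuller p r ∈ (I • ⊤ : Submodule ℤ_[p] (WittVector p R)) := by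
    rw [← Submodule.Quotient.mk_eq_zero]
    refine (TensorProduct.tensorQuotEquivQuotSMul (WittVector p R) I).symm.map_eq_zero_iff.mp ?_
    rw [TensorProduct.tensorQuotEquivQuotSMul_symm_mk]
    exact h2
  have h5 : ∀ ω ∈ (I • ⊤ : Submodule ℤ_[p] (WittVector p R)), constantCoeff ω = 0 := by
    intro ω hω
    refine Submodule.smul_induction_on hω ?_ ?_
    · intro c hc y _
      obtain ⟨d, rfl⟩ := Ideal.mem_span_singleton'.mp hc
      rw [mul_smul, natCast_smul, Algebra.smul_def, map_mul, map_mul, map_natCast]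
      simp
    · intro a b ha hb
      rw [map_add, ha, hb, add_zero]
  simpa [constantCoeff] using h5 _ h4

theorem exists_teichTensor_eq (hz : (p : ℤ_[p]) • z = 0) (q : M →ₗ[ℤ_[p]] M')
    (hq : Function.Surjective q) (hqz : q z = 0) (hker : ∀ x, q x = 0 → ∃ c : ℤ_[p], c • z = x)
    {w : WittVector p R ⊗[ℤ_[p]] M} (hw : q.lTensor (WittVector p R) w = 0) :
    ∃ r : R, w = teichTensor R z r := by
  have hex : Function.Exact (LinearMap.toSpanSingleton ℤ_[p] M z) q := by
    intro x
    constructor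
    · intro hx
      obtain ⟨c, hc⟩ := hker x hx
      exact ⟨c, by simpa using hc⟩
    · rintro ⟨c, rfl⟩
      simp [hqz]
  obtain ⟨v, rfl⟩ := (lTensor_exact (WittVector p R) hex hq w).mp hw
  -- By right exactness the kernel is the image of `W(R) ⊗ ℤ_[p] z`, and `ω ⊗ z` depends only on the
  -- coefficient `0` of `ω`.
  refine ⟨(TensorProduct.rid ℤ_[p] _ v).coeff 0, ?_⟩
  rw [← tmul_eq_teichTensor hz]
  obtain ⟨ω, rfl⟩ := (TensorProduct.rid ℤ_[p] (WittVector p R)).symm.surjective v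
  simp

end

end WittTensor

/-! ### Functoriality of `𝔤 ⊗ W(R)` -/

section Functoriality

variable {p : ℕ} [Fact p.Prime] {𝔤 𝔥 : Type*} [LieRing 𝔤] [LieAlgebra ℤ_[p] 𝔤]
  [LieRing 𝔥] [LieAlgebra ℤ_[p] 𝔥] {R S T : Type*} [CommRing R] [CharP R p]
  [CommRing S] [CharP S p] [CommRing T] [CharP T p]

theorem lieWittMap_tmul (f : R →+* S) (ω : WittVector p R) (x : 𝔤) :
    lieWittMap p 𝔤 f (ω ⊗ₜ x) = WittVector.map f ω ⊗ₜ x := rfl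

theorem lieWittMap_comp (g : S →+* T) (f : R →+* S) (w : LieWitt p 𝔤 R) :
    lieWittMap p 𝔤 g (lieWittMap p 𝔤 f w) = lieWittMap p 𝔤 (g.comp f) w := by
  induction w using TensorProduct.induction_on with
  | zero => simp
  | add a b ha hb => simp [ha, hb]
  | tmul ω x =>
    rw [lieWittMap_tmul, lieWittMap_tmul, lieWittMap_tmul]
    congr 1

theorem lieWittMap_teichTensor (f : R →+* S) (z : 𝔤) (r : R) :
    lieWittMap p 𝔤 f (teichTensor R z r) = teichTensor S z (f r) := by
  rw [teichTensor, lieWittMap_tmul, WittVector.map_teichmuller, teichTensor]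

theorem lieWittMap_incl (f : R →+* S) (x : 𝔤) :
    lieWittMap p 𝔤 f (lieWittIncl p 𝔤 R x) = lieWittIncl p 𝔤 S x := by
  rw [lieWittIncl, lieWittMap_tmul, map_one, lieWittIncl]

/-- The canonical map `𝔤 → 𝔤 ⊗ W(R)`, as a homomorphism of Lie algebras. -/
def lieWittInclHom (p : ℕ) [Fact p.Prime] (𝔤 : Type*) [LieRing 𝔤] [LieAlgebra ℤ_[p] 𝔤]
    (R : Type*) [CommRing R] [CharP R p] : 𝔤 →ₗ⁅ℤ_[p]⁆ LieWitt p 𝔤 R where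
  toLinearMap := TensorProduct.mk ℤ_[p] (WittVector p R) 𝔤 1
  map_lie' {x y} := by simp

theorem lieWittInclHom_apply (x : 𝔤) : lieWittInclHom p 𝔤 R x = lieWittIncl p 𝔤 R x := rfl

/-- The map `𝔤 ⊗ W(R) → 𝔥 ⊗ W(R)` induced by a homomorphism `𝔤 → 𝔥`. -/
def lieWittRight (R : Type*) [CommRing R] [CharP R p] (q : 𝔤 →ₗ⁅ℤ_[p]⁆ 𝔥) :
    LieWitt p 𝔤 R →ₗ⁅ℤ_[p]⁆ LieWitt p 𝔥 R :=
  LieAlgebra.ExtendScalars.map (AlgHom.id _ _) q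

theorem lieWittRight_lieWittMap (q : 𝔤 →ₗ⁅ℤ_[p]⁆ 𝔥) (f : R →+* S) (w : LieWitt p 𝔤 R) :
    lieWittRight S q (lieWittMap p 𝔤 f w) = lieWittMap p 𝔥 f (lieWittRight R q w) := by
  induction w using TensorProduct.induction_on with
  | zero => simp
  | add a b ha hb => simp [ha, hb]
  | tmul ω x => rfl

theorem lieWittRight_incl (q : 𝔤 →ₗ⁅ℤ_[p]⁆ 𝔥) (x : 𝔤) :
    lieWittRight R q (lieWittIncl p 𝔤 R x) = lieWittIncl p 𝔥 R (q x) := rfl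

theorem lieWittRight_surjective {q : 𝔤 →ₗ⁅ℤ_[p]⁆ 𝔥} (hq : Function.Surjective q) :
    Function.Surjective (lieWittRight R q) :=
  LinearMap.lTensor_surjective (WittVector p R) (g := (q : 𝔤 →ₗ[ℤ_[p]] 𝔥)) hq

theorem lie_teichTensor {z : 𝔤} (hz : ∀ x : 𝔤, ⁅x, z⁆ = 0) (r : R) (w : LieWitt p 𝔤 R) :
    ⁅w, teichTensor R z r⁆ = 0 := by
  induction w using TensorProduct.induction_on with
  | zero => simp
  | add a b ha hb => rw [add_lie, ha, hb, add_zero]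
  | tmul ω x =>
    rw [teichTensor, LieAlgebra.ExtendScalars.bracket_tmul, hz, TensorProduct.tmul_zero]

theorem lieWittIncl_natCast_smul [PerfectRing R p] {z : 𝔤} (hz : (p : ℤ_[p]) • z = 0) (n : ℕ) :
    lieWittIncl p 𝔤 R ((n : ℤ_[p]) • z) = teichTensor R z (n : R) := by
  rw [lieWittIncl, ← TensorProduct.smul_tmul, tmul_eq_teichTensor hz, WittVector.natCast_smul,
    one_mul]
  congr 1
  exact map_natCast (WittVector.constantCoeff (p := p) (R := R)) n

theorem IsBCHGroupLaw.bch_add_teichTensor [PerfectRing R p] (hL : IsBCHGroupLaw p (LieWitt p 𝔤 R))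
    {z : 𝔤} (hz : (p : ℤ_[p]) • z = 0) (hz' : ∀ x : 𝔤, ⁅x, z⁆ = 0) (x y : LieWitt p 𝔤 R) (r s : R) :
    bch p (x + teichTensor R z r) (y + teichTensor R z s) = bch p x y + teichTensor R z (r + s) := by
  rw [hL.bch_add_central x y (lie_teichTensor hz' r) (lie_teichTensor hz' s), teichTensor_add hz]

/-- This is the engine of the dévissage: a solution over `𝔥`, lifted to `𝔤`, is wrong only by an
element of `R`. -/
theorem IsCentralExt.exists_eq_add_teichTensor [PerfectRing R p] {q : 𝔤 →ₗ⁅ℤ_[p]⁆ 𝔥} {z : 𝔤}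
    (hq : IsCentralExt q z) {v w : LieWitt p 𝔤 R} (h : lieWittRight R q v = lieWittRight R q w) :
    ∃ r : R, v = w + teichTensor R z r := by
  obtain ⟨r, hr⟩ := exists_teichTensor_eq (R := R) hq.smul_eq_zero (q : 𝔤 →ₗ[ℤ_[p]] 𝔥) hq.surj
    hq.map_eq_zero hq.exact (w := v - w) (by
      change lieWittRight R q (v - w) = 0
      rw [map_sub, h, sub_self])
  exact ⟨r, by rw [← hr, add_sub_cancel]⟩

end Functoriality

/-! ### Dévissage -/

section Devissage

universe u

variable {p : ℕ} [Fact p.Prime] {R S : Type*} [CommRing R] [CharP R p]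
  [CommRing S] [CharP S p] [PerfectRing S p] {𝔤 : Type u} [LieRing 𝔤] [LieAlgebra ℤ_[p] 𝔤] [Finite 𝔤]

/-- The Baker-Campbell-Hausdorff group law on `𝔤 ⊗ W(R)`. -/
theorem LieFiltration.isBCHGroupLaw_lieWitt {𝔤 : Type*} [LieRing 𝔤] [LieAlgebra ℤ_[p] 𝔤]
    (Φ : LieFiltration p 𝔤) (R : Type*) [CommRing R] [CharP R p] :
    IsBCHGroupLaw p (LieWitt p 𝔤 R) :=
  (Φ.baseChange (WittVector p R)).isBCHGroupLaw

theorem LieFiltration.lieWittIncl_injective (Φ : LieFiltration p 𝔤) (R : Type*) [CommRing R]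
    [CharP R p] [PerfectRing R p] [IsDomain R] :
    Function.Injective (lieWittIncl p 𝔤 R) := by
  suffices h : ∀ x, lieWittInclHom p 𝔤 R x = 0 → x = 0 from
    (injective_iff_map_eq_zero (lieWittInclHom p 𝔤 R)).mpr h
  refine finite_lie_induction (p := p) (fun 𝔤 _ _ => ∀ x, lieWittInclHom p 𝔤 R x = 0 → x = 0)
    (fun 𝔤 _ _ _ x _ => Subsingleton.elim _ _) ?_ 𝔤 Φ
  intro 𝔤 𝔥 _ _ _ _ _ _ q z hq ih x hx
  have hqx : q x = 0 := ih _ (by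
    rw [lieWittInclHom_apply, ← lieWittRight_incl, ← lieWittInclHom_apply, hx, map_zero])
  obtain ⟨c, rfl⟩ := hq.exact x hqx
  -- A unit `c` would give `[1] ⊗ z = 0`; otherwise `c` is divisible by `p`, which kills `z`.
  by_cases hc : IsUnit c
  · rw [map_smul, hc.smul_eq_zero, lieWittInclHom_apply, lieWittIncl,
      tmul_eq_teichTensor hq.smul_eq_zero, ← teichTensor_zero z] at hx
    exact absurd (teichTensor_injective hq.smul_eq_zero hq.ne_zero hx) (by simp)
  · have hc' : c ∈ Ideal.span {(p : ℤ_[p])} := by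
      rwa [← PadicInt.maximalIdeal_eq_span_p, IsLocalRing.mem_maximalIdeal, mem_nonunits_iff]
    obtain ⟨d, rfl⟩ := Ideal.mem_span_singleton'.mp hc'
    rw [mul_smul, hq.smul_eq_zero, smul_zero]

theorem LieFiltration.lieWittMap_injective [PerfectRing R p] [IsDomain S]
    (Φ : LieFiltration p 𝔤) {f : R →+* S}
    (hf : Function.Injective f) : Function.Injective (lieWittMap p 𝔤 f) := by
  suffices h : ∀ x, lieWittMap p 𝔤 f x = 0 → x = 0 from
    (injective_iff_map_eq_zero (lieWittMap p 𝔤 f)).mpr h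
  refine finite_lie_induction (p := p) (fun 𝔤 _ _ => ∀ x, lieWittMap p 𝔤 f x = 0 → x = 0)
    (fun 𝔤 _ _ _ x _ => Subsingleton.elim _ _) ?_ 𝔤 Φ
  intro 𝔤 𝔥 _ _ _ _ _ _ q z hq ih w hw
  have hqw : lieWittRight R q w = 0 := ih _ (by rw [← lieWittRight_lieWittMap, hw, map_zero])
  obtain ⟨r, hr⟩ := hq.exists_eq_add_teichTensor (v := w) (w := 0) (by rw [hqw, map_zero])
  rw [zero_add] at hr
  rw [hr, lieWittMap_teichTensor, ← teichTensor_zero z] at hw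
  have h0 : r = 0 := hf (by
    rw [map_zero]; exact teichTensor_injective hq.smul_eq_zero hq.ne_zero hw)
  rw [hr, h0, teichTensor_zero]

/-- A lift of the solution over `𝔥` misses `g` by some `r` with `r ^ p = r`. Such an `r` is the
image of an integer `n`, and `n • z` corrects the lift. -/
theorem LieFiltration.exists_lieWittIncl_eq [PerfectRing R p] [IsDomain R] (Φ : LieFiltration p 𝔤)
    (hfix : ∀ r : R, r ^ p = r → ∃ n : ℕ, (n : R) = r) (g : LieWitt p 𝔤 R)
    (hg : lieWittFrob p 𝔤 R g = g) : ∃ x, lieWittIncl p 𝔤 R x = g := by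
  refine finite_lie_induction (p := p)
    (fun 𝔤 _ _ => ∀ g, lieWittFrob p 𝔤 R g = g → ∃ x, lieWittIncl p 𝔤 R x = g)
    (fun 𝔤 _ _ _ g _ => ⟨0, Subsingleton.elim _ _⟩) ?_ 𝔤 Φ g hg
  intro 𝔤 𝔥 _ _ _ _ _ _ q z hq ih g hg
  obtain ⟨y, hy⟩ := ih (lieWittRight R q g) (by
    rw [lieWittFrob, ← lieWittRight_lieWittMap]; exact congrArg _ hg)
  obtain ⟨x, rfl⟩ := hq.surj y
  obtain ⟨r, hr⟩ := hq.exists_eq_add_teichTensor (v := g) (w := lieWittIncl p 𝔤 R x) hy.symm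
  rw [hr, lieWittFrob, map_add, lieWittMap_incl, lieWittMap_teichTensor, add_right_inj] at hg
  obtain ⟨n, hn⟩ := hfix r (teichTensor_injective hq.smul_eq_zero hq.ne_zero hg)
  refine ⟨x + (n : ℤ_[p]) • z, ?_⟩
  rw [hr, ← hn, ← lieWittIncl_natCast_smul hq.smul_eq_zero, ← lieWittInclHom_apply, map_add]
  rfl

theorem LieFiltration.exists_lieWittMap_eq [IsDomain S] (Φ : LieFiltration p 𝔤) {Γ : Type*}
    {act : Γ → S →+* S} {f : R →+* S} (hf : ∀ τ r, act τ (f r) = f r)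
    (hfix : ∀ s, (∀ τ, act τ s = s) → ∃ r, f r = s) (g : LieWitt p 𝔤 S)
    (hg : ∀ τ, lieWittMap p 𝔤 (act τ) g = g) : ∃ m, lieWittMap p 𝔤 f m = g := by
  refine finite_lie_induction (p := p)
    (fun 𝔤 _ _ => ∀ g, (∀ τ, lieWittMap p 𝔤 (act τ) g = g) → ∃ m, lieWittMap p 𝔤 f m = g)
    (fun 𝔤 _ _ _ g _ => ⟨0, Subsingleton.elim _ _⟩) ?_ 𝔤 Φ g hg
  intro 𝔤 𝔥 _ _ _ _ _ _ q z hq ih g hg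
  obtain ⟨m', hm'⟩ := ih (lieWittRight S q g) fun τ => by rw [← lieWittRight_lieWittMap, hg]
  obtain ⟨m, rfl⟩ := lieWittRight_surjective hq.surj m'
  obtain ⟨s, hs⟩ := hq.exists_eq_add_teichTensor (v := g) (w := lieWittMap p 𝔤 f m) (by
    rw [← hm', lieWittRight_lieWittMap])
  obtain ⟨r, hr⟩ := hfix s fun τ => by
    have h := hg τ
    have hcomp : (act τ).comp f = f := RingHom.ext (hf τ)
    rw [hs, map_add, lieWittMap_comp, hcomp, lieWittMap_teichTensor, add_right_inj] at h
    exact teichTensor_injective hq.smul_eq_zero hq.ne_zero h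
  exact ⟨m + teichTensor R z r, by rw [map_add, lieWittMap_teichTensor, hr, hs]⟩

/-- Changing `g` by `[a] ⊗ z` changes `σ(g) ∘ (-g)` by `[a ^ p - a] ⊗ z`, so the error is removed by
an Artin-Schreier equation. -/
theorem LieFiltration.artinSchreier_surjective [PerfectRing R p] (Φ : LieFiltration p 𝔤)
    (hAS : ∀ r : R, ∃ a : R, a ^ p - a = r) : Function.Surjective (artinSchreier p 𝔤 R) := by
  refine finite_lie_induction (p := p)
    (fun 𝔤 _ _ => Function.Surjective (artinSchreier p 𝔤 R))
    (fun 𝔤 _ _ _ m => ⟨0, Subsingleton.elim _ _⟩) ?_ 𝔤 Φ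
  intro 𝔤 𝔥 _ _ _ _ _ Φ q z hq ih m
  obtain ⟨g', hg'⟩ := ih (lieWittRight R q m)
  obtain ⟨g, rfl⟩ := lieWittRight_surjective hq.surj g'
  obtain ⟨r, hr⟩ := hq.exists_eq_add_teichTensor (v := m) (w := artinSchreier p 𝔤 R g) (by
    rw [← hg', artinSchreier, artinSchreier, map_bch, map_neg, lieWittFrob, lieWittFrob,
      lieWittRight_lieWittMap])
  obtain ⟨a, ha⟩ := hAS r
  refine ⟨g + teichTensor R z a, ?_⟩
  rw [artinSchreier, lieWittFrob, map_add, lieWittMap_teichTensor, neg_add,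
    ← teichTensor_neg hq.smul_eq_zero, (Φ.isBCHGroupLaw_lieWitt R).bch_add_teichTensor
      hq.smul_eq_zero hq.lie_eq_zero, frobenius_def, ← sub_eq_add_neg, ha, hr]
  rfl

/-- Each `x` is killed by a power of `p`, so `ω ⊗ x` involves only finitely many Teichmüller
components of `ω`, and finitely many stabilizing conditions suffice. -/
theorem eventually_lieWittMap_eq {Γ : Type*} {act : Γ → S →+* S} {l : Filter Γ}
    (hl : ∀ s, ∀ᶠ τ in l, act τ s = s) (g : LieWitt p 𝔤 S) :
    ∀ᶠ τ in l, lieWittMap p 𝔤 (act τ) g = g := by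
  induction g using TensorProduct.induction_on with
  | zero => simp
  | add a b ha hb =>
    filter_upwards [ha, hb] with τ ha hb
    rw [map_add, ha, hb]
  | tmul ω x =>
    obtain ⟨n, hn⟩ := exists_pow_smul_eq_zero (p := p) x
    induction n generalizing ω x with
    | zero => simp_all
    | succ n ih =>
      obtain ⟨y, hy⟩ := WittVector.exists_eq_teichmuller_add ω
      rw [pow_succ, mul_smul] at hn
      filter_upwards [ih y _ hn, hl (ω.coeff 0)] with τ h1 h2
      rw [hy, TensorProduct.add_tmul, ← WittVector.natCast_smul, TensorProduct.smul_tmul, map_add,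
        h1, lieWittMap_tmul, WittVector.map_teichmuller, h2]

/-- A solution over `𝔥` lifts to a `g` whose coboundary `u` differs from `γ` by a central `c`. As
both are cocycles, `c` is an additive cocycle, and writing it as a coboundary of `a` corrects `g`.
-/
theorem LieFiltration.exists_eq_bch_neg [IsDomain S] (Φ : LieFiltration p 𝔤) {Γ : Type*} [Group Γ]
    {act : Γ → S →+* S} (hact : ∀ τ ρ s, act (τ * ρ) s = act τ (act ρ s)) {l : Filter Γ}
    (hl : ∀ s, ∀ᶠ τ in l, act τ s = s)
    (hH : ∀ c : Γ → S, (∀ τ ρ, c (τ * ρ) = c τ + act τ (c ρ)) → (∀ᶠ τ in l, c τ = 0) →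
      ∃ a, ∀ τ, c τ = act τ a - a)
    (γ : Γ → 𝔤) (hγ : ∀ τ ρ, γ (τ * ρ) = bch p (γ τ) (γ ρ)) (hγl : ∀ᶠ τ in l, γ τ = 0) :
    ∃ g, ∀ τ, lieWittIncl p 𝔤 S (γ τ) = bch p (-g) (lieWittMap p 𝔤 (act τ) g) := by
  refine finite_lie_induction (p := p)
    (fun 𝔤 _ _ => ∀ γ : Γ → 𝔤, (∀ τ ρ, γ (τ * ρ) = bch p (γ τ) (γ ρ)) → (∀ᶠ τ in l, γ τ = 0) →
      ∃ g, ∀ τ, lieWittIncl p 𝔤 S (γ τ) = bch p (-g) (lieWittMap p 𝔤 (act τ) g))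
    (fun 𝔤 _ _ _ γ _ _ => ⟨0, fun τ => Subsingleton.elim _ _⟩) ?_ 𝔤 Φ γ hγ hγl
  intro 𝔤 𝔥 _ _ _ _ _ Φ q z hq ih γ hγ hγl
  have hL := Φ.isBCHGroupLaw_lieWitt S
  have hpz := hq.smul_eq_zero
  obtain ⟨g', hg'⟩ := ih (fun τ => q (γ τ)) (fun τ ρ => by rw [hγ, map_bch])
    (hγl.mono fun τ h => by rw [h, map_zero])
  obtain ⟨g, rfl⟩ := lieWittRight_surjective hq.surj g'
  set u : Γ → LieWitt p 𝔤 S := fun τ => bch p (-g) (lieWittMap p 𝔤 (act τ) g) with hu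
  have hex : ∀ τ, ∃ c : S, lieWittIncl p 𝔤 S (γ τ) = u τ + teichTensor S z c := fun τ =>
    hq.exists_eq_add_teichTensor (by
      rw [lieWittRight_incl, hg', hu, map_bch, map_neg, lieWittRight_lieWittMap])
  choose c hc using hex
  have hinj := teichTensor_injective (R := S) hpz hq.ne_zero
  have hmul : ∀ τ ρ, u (τ * ρ) = bch p (u τ) (lieWittMap p 𝔤 (act τ) (u ρ)) := fun τ ρ => by
    have h1 : (act τ).comp (act ρ) = act (τ * ρ) := RingHom.ext fun s => (hact τ ρ s).symm
    have h2 : ∀ x y : LieWitt p 𝔤 S, bch p x (bch p (-x) y) = y := fun x y => by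
      have h3 := hL.neg_bch (-x)
      rw [neg_neg] at h3
      rw [← hL.assoc, h3, hL.zero_bch]
    rw [hu]
    simp only
    rw [map_bch, map_neg, hL.assoc, h2, lieWittMap_comp, h1]
  -- The action fixes the image of `𝔤`, so the homomorphism `γ` is also a cocycle. Near the identity
  -- both `γ` and `u` vanish, hence so does `c`.
  obtain ⟨a, ha⟩ := hH c
    (fun τ ρ => by
      apply hinj
      rw [← add_right_inj (u (τ * ρ)), ← hc, hγ, ← lieWittInclHom_apply, map_bch,
        lieWittInclHom_apply, lieWittInclHom_apply, ← lieWittMap_incl (act τ) (γ ρ), hc, hc,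
        map_add, lieWittMap_teichTensor, hL.bch_add_teichTensor hpz hq.lie_eq_zero, hmul])
    (by
      filter_upwards [hγl, eventually_lieWittMap_eq hl g] with τ h1 h2
      apply hinj
      have h3 := hc τ
      rw [h1, hu, ← lieWittInclHom_apply, map_zero] at h3
      simp only at h3
      rw [h2, hL.neg_bch, zero_add] at h3
      rw [← h3, teichTensor_zero])
  refine ⟨g + teichTensor S z a, fun τ => ?_⟩
  rw [hc, map_add, lieWittMap_teichTensor, neg_add, ← teichTensor_neg hpz,
    hL.bch_add_teichTensor hpz hq.lie_eq_zero, ha, neg_add_eq_sub]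

end Devissage

/-! ### The Galois action on the perfect closure of a separable closure -/

section PerfectClosure

variable {p : ℕ} [Fact p.Prime] {K K' K'' : Type*} [CommRing K] [CharP K p] [CommRing K'] [CharP K' p]
  [CommRing K''] [CharP K'' p]

theorem perfMap_of (f : K →+* K') (x : K) :
    perfMap p f (PerfectClosure.of K p x) = PerfectClosure.of K' p (f x) :=
  RingHom.congr_fun ((PerfectClosure.lift K p _).symm_apply_apply ((PerfectClosure.of K' p).comp f)) x

theorem PerfectClosure.frobenius_iterate_injective (n : ℕ) :
    Function.Injective (frobenius (PerfectClosure K p) p)^[n] :=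
  (injective_frobenius (PerfectClosure K p) p).iterate n

/-- The class of `(n, x)` is the `p ^ n`-th root of `x`, so it suffices to compare `p ^ n`-th
powers. -/
theorem perfMap_mk (f : K →+* K') (n : ℕ) (x : K) :
    perfMap p f (PerfectClosure.mk K p (n, x)) = PerfectClosure.mk K' p (n, f x) := by
  apply PerfectClosure.frobenius_iterate_injective n
  rw [← RingHom.map_iterate_frobenius, PerfectClosure.iterate_frobenius_mk,
    PerfectClosure.iterate_frobenius_mk, perfMap_of]

theorem perfMap_perfMap (g : K' →+* K'') (f : K →+* K') (r : PerfectClosure K p) :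
    perfMap p g (perfMap p f r) = perfMap p (g.comp f) r := by
  induction r using PerfectClosure.induction_on with
  | _ x =>
    obtain ⟨n, x⟩ := x
    simp only [perfMap_mk, RingHom.comp_apply]

theorem PerfectClosure.mk_injective [IsReduced K] (n : ℕ) {x y : K}
    (h : PerfectClosure.mk K p (n, x) = PerfectClosure.mk K p (n, y)) : x = y := by
  rw [PerfectClosure.eq_iff] at h
  exact (frobenius_inj K p).iterate n h

theorem PerfectClosure.exists_pow_sub_eq (h : ∀ x : K, ∃ a : K, a ^ p - a = x)
    (r : PerfectClosure K p) : ∃ a : PerfectClosure K p, a ^ p - a = r := by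
  induction r using PerfectClosure.induction_on with
  | _ x =>
    obtain ⟨n, x⟩ := x
    obtain ⟨b, rfl⟩ := h x
    refine ⟨PerfectClosure.mk K p (n, b), PerfectClosure.frobenius_iterate_injective n ?_⟩
    simp only [iterate_map_sub, iterate_map_pow, PerfectClosure.iterate_frobenius_mk, map_sub,
      map_pow]

end PerfectClosure

theorem exists_natCast_eq_of_pow_eq {p : ℕ} [Fact p.Prime] {K : Type*} [Field K] [CharP K p] {x : K}
    (hx : x ^ p = x) : ∃ n : ℕ, (n : K) = x := by
  obtain ⟨n, hn⟩ := (mem_bot_iff_intCast p K).mp ((Subfield.mem_bot_iff_pow_eq_self K p).mpr hx)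
  refine ⟨(n : ZMod p).val, ?_⟩
  rw [← hn, ← map_natCast (ZMod.castHom dvd_rfl K), ZMod.natCast_zmod_val, map_intCast]

/-- The Artin-Schreier polynomial has derivative `-1`, hence is separable. -/
theorem IsSepClosed.exists_pow_sub_eq {p : ℕ} [Fact p.Prime] {K : Type*} [Field K] [CharP K p]
    [IsSepClosed K] (x : K) : ∃ a : K, a ^ p - a = x := by
  obtain ⟨a, ha⟩ := IsSepClosed.exists_root_C_mul_X_pow_add_C_mul_X_add_C' p p (1 : K) (-1) (-x)
    dvd_rfl (Fact.out : p.Prime).two_le (by simp)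
  exact ⟨a, by linear_combination ha⟩

section Galois

open Topology Filter

variable {p : ℕ} [Fact p.Prime] {F Fsep : Type*} [Field F] [Field Fsep] [CharP Fsep p]
  [Algebra F Fsep]

variable (p) in
/-- The action of the Galois group on the perfect closure. -/
def perfAct (τ : Gal(Fsep/F)) : PerfectClosure Fsep p →+* PerfectClosure Fsep p :=
  perfMap p (τ : Fsep →+* Fsep)

theorem perfAct_mk (τ : Gal(Fsep/F)) (n : ℕ) (x : Fsep) :
    perfAct p τ (PerfectClosure.mk Fsep p (n, x)) = PerfectClosure.mk Fsep p (n, τ x) :=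
  perfMap_mk _ n x

theorem perfAct_mul (τ ρ : Gal(Fsep/F)) (r : PerfectClosure Fsep p) :
    perfAct p (τ * ρ) r = perfAct p τ (perfAct p ρ r) :=
  (perfMap_perfMap (τ : Fsep →+* Fsep) (ρ : Fsep →+* Fsep) r).symm

theorem perfAct_perfMap [CharP F p] (τ : Gal(Fsep/F)) (r : PerfectClosure F p) :
    perfAct p τ (perfMap p (algebraMap F Fsep) r) = perfMap p (algebraMap F Fsep) r := by
  rw [perfAct, perfMap_perfMap]
  congr 1
  congr 1
  ext x
  exact τ.commutes x

theorem exists_perfMap_eq [CharP F p] [IsGalois F Fsep] (s : PerfectClosure Fsep p)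
    (hs : ∀ τ : Gal(Fsep/F), perfAct p τ s = s) : ∃ r, perfMap p (algebraMap F Fsep) r = s := by
  induction s using PerfectClosure.induction_on with
  | _ x =>
    obtain ⟨n, x⟩ := x
    obtain ⟨y, rfl⟩ := (InfiniteGalois.mem_range_algebraMap_iff_fixed (k := F) x).mpr fun τ =>
      PerfectClosure.mk_injective (p := p) n (by rw [← perfAct_mk, hs])
    exact ⟨PerfectClosure.mk F p (n, y), perfMap_mk _ n y⟩

theorem eventually_perfAct_eq [IsGalois F Fsep] (s : PerfectClosure Fsep p) :
    ∀ᶠ τ : Gal(Fsep/F) in 𝓝 1, perfAct p τ s = s := by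
  induction s using PerfectClosure.induction_on with
  | _ x =>
    obtain ⟨n, x⟩ := x
    filter_upwards [(stabilizer_isOpen_of_isIntegral (K := F) x).mem_nhds (one_mem _)] with τ hτ
    rw [perfAct_mk, show τ x = x from hτ]

/-- The additive form of Hilbert 90. -/
theorem exists_eq_perfAct_sub [IsGalois F Fsep] (c : Gal(Fsep/F) → PerfectClosure Fsep p)
    (hc : ∀ τ ρ, c (τ * ρ) = c τ + perfAct p τ (c ρ)) (hcl : ∀ᶠ τ in 𝓝 1, c τ = 0) :
    ∃ a, ∀ τ, c τ = perfAct p τ a - a := by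
  -- By continuity the cocycle vanishes on the group fixing a finite Galois extension `E`, so it
  -- factors through `Gal(E/F)`. An element `θ` of trace `1` then supports the usual averaging
  -- argument.
  obtain ⟨E, hE, hEn, hEc⟩ := (krullTopology_mem_nhds_one_iff_of_normal F Fsep _).mp hcl
  have hgal : IsGalois F E := ⟨⟩
  obtain ⟨θ, hθ⟩ := Algebra.trace_surjective F E 1
  have hsum := trace_eq_sum_automorphisms (K := F) θ
  rw [hθ, map_one] at hsum
  have hsurj := AlgEquiv.restrictNormalHom_surjective (F := F) (K₁ := E) Fsep
  set π := AlgEquiv.restrictNormalHom (F := F) (K₁ := Fsep) E with hπ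
  choose t ht using hsurj
  have hker : ∀ τ κ, π τ = π κ → c τ = c κ := by
    intro τ κ h
    have h1 : κ⁻¹ * τ ∈ E.fixingSubgroup := by
      rw [IntermediateField.mem_fixingSubgroup_iff]
      refine (AlgEquiv.restrictNormal_eq_one_iff E _).mp ?_
      change π (κ⁻¹ * τ) = 1
      rw [map_mul, map_inv, h, inv_mul_cancel]
    have h2 : c (κ⁻¹ * τ) = 0 := hEc h1
    rw [← mul_inv_cancel_left κ τ, hc, h2, map_zero, add_zero]
  let o : E →+* PerfectClosure Fsep p := (PerfectClosure.of Fsep p).comp (algebraMap E Fsep)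
  have ho : ∀ τ x, perfAct p τ (o x) = o (π τ x) := fun τ x => by
    change perfAct p τ (PerfectClosure.of Fsep p x) = PerfectClosure.of Fsep p (algebraMap E Fsep _)
    rw [hπ, AlgEquiv.restrictNormalHom, MonoidHom.mk'_apply, AlgEquiv.restrictNormal_commutes]
    exact perfMap_of _ _
  -- Applying `τ` permutes the summands and subtracts `c τ` times the trace of `θ`, which is `1`.
  -- The values of `c` need not lie in `E`.
  refine ⟨-∑ ρ : Gal(E/F), c (t ρ) * o (ρ θ), fun τ => ?_⟩
  have key : perfAct p τ (∑ ρ : Gal(E/F), c (t ρ) * o (ρ θ)) =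
      ∑ ρ : Gal(E/F), c (t ρ) * o (ρ θ) - c τ := by
    rw [map_sum]
    have h1 : ∀ ρ : Gal(E/F), perfAct p τ (c (t ρ) * o (ρ θ)) =
        c (t (π τ * ρ)) * o ((π τ * ρ) θ) - c τ * o ((π τ * ρ) θ) := fun ρ => by
      rw [map_mul, ho, hker (t (π τ * ρ)) (τ * t ρ) (by rw [ht, map_mul, ht]), hc]
      rw [AlgEquiv.mul_apply]
      ring
    rw [Finset.sum_congr rfl fun ρ _ => h1 ρ, Finset.sum_sub_distrib, ← Finset.mul_sum,
      (Group.mulLeft_bijective (π τ)).sum_comp fun ρ : Gal(E/F) => c (t ρ) * o (ρ θ),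
      (Group.mulLeft_bijective (π τ)).sum_comp fun ρ : Gal(E/F) => o (ρ θ), ← map_sum, ← hsum,
      map_one, mul_one]
  rw [map_neg, key]
  ring

end Galois

/-! ### The lower central series -/

section LowerCentralSeries

open LieModule

variable {p : ℕ} [Fact p.Prime] {R 𝔤 : Type*} [CommRing R] [LieRing 𝔤] [LieAlgebra R 𝔤]

theorem lie_mem_lowerCentralSeries_succ {b : ℕ} (x : 𝔤) {y : 𝔤}
    (hy : y ∈ lowerCentralSeries R 𝔤 𝔤 b) : ⁅x, y⁆ ∈ lowerCentralSeries R 𝔤 𝔤 (b + 1) := by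
  rw [lowerCentralSeries_succ]
  exact LieSubmodule.lie_mem_lie (LieSubmodule.mem_top x) hy

/-- Induction on `a`: the Jacobi identity moves the outer bracket of `[[v, w], y]` onto terms with
`w` of depth `a`. -/
theorem lie_mem_lowerCentralSeries_add {a b : ℕ} {x y : 𝔤} (hx : x ∈ lowerCentralSeries R 𝔤 𝔤 a)
    (hy : y ∈ lowerCentralSeries R 𝔤 𝔤 b) : ⁅x, y⁆ ∈ lowerCentralSeries R 𝔤 𝔤 (a + b + 1) := by
  induction a generalizing b x y with
  | zero => rw [zero_add]; exact lie_mem_lowerCentralSeries_succ x hy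
  | succ a ih =>
    rw [lowerCentralSeries_succ, ← LieSubmodule.mem_toSubmodule,
      LieSubmodule.lieIdeal_oper_eq_linear_span'] at hx
    induction hx using Submodule.span_induction with
    | mem u hu =>
      obtain ⟨v, -, w, hw, rfl⟩ := hu
      rw [lie_lie]
      refine sub_mem ?_ ?_
      · rw [show a + 1 + b + 1 = (a + b + 1) + 1 by omega]
        exact lie_mem_lowerCentralSeries_succ v (ih hw hy)
      · rw [show a + 1 + b + 1 = a + (b + 1) + 1 by omega]
        exact ih hw (lie_mem_lowerCentralSeries_succ v hy)
    | zero => rw [zero_lie]; exact zero_mem _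
    | add u v _ _ hu hv => rw [add_lie]; exact add_mem hu hv
    | smul c u _ hu => rw [smul_lie]; exact SMulMemClass.smul_mem c hu

/-- The filtration by the lower central series. -/
def LieFiltration.ofNilpotencyLength [LieAlgebra ℤ_[p] 𝔤] [LieRing.IsNilpotent 𝔤]
    (h : nilpotencyLength 𝔤 𝔤 < p) : LieFiltration p 𝔤 where
  -- The series starts at index `0`, hence the shift; truncated subtraction makes `C 0 = C 1`, the
  -- whole algebra.
  C i := lowerCentralSeries ℤ_[p] 𝔤 𝔤 (i - 1)
  anti := fun i j hij => antitone_lowerCentralSeries ℤ_[p] 𝔤 𝔤 (Nat.sub_le_sub_right hij 1)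
  mem_one x := LieSubmodule.mem_top (R := ℤ_[p]) (L := 𝔤) x
  lie_mem := by
    intro i j x y hx hy
    exact antitone_lowerCentralSeries ℤ_[p] 𝔤 𝔤 (by omega) (lie_mem_lowerCentralSeries_add hx hy)
  eq_zero := by
    intro x hx
    -- The nilpotency length refers to the series over `ℤ`, which has the same underlying sets as
    -- the one over `ℤ_[p]`.
    have h1 : lowerCentralSeries ℤ 𝔤 𝔤 (nilpotencyLength 𝔤 𝔤) = ⊥ :=
      Nat.sInf_mem (s := {k | lowerCentralSeries ℤ 𝔤 𝔤 k = ⊥}) (IsNilpotent.nilpotent ℤ 𝔤 𝔤)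
    have h2 := antitone_lowerCentralSeries ℤ_[p] 𝔤 𝔤 (show nilpotencyLength 𝔤 𝔤 ≤ p - 1 by omega) hx
    rw [← SetLike.mem_coe, coe_lowerCentralSeries_eq_int, h1] at h2
    exact h2

end LowerCentralSeries

/-! ### Orbits and conjugacy classes of homomorphisms -/

section Orbits

open Topology MulAction

/-- Commuting actions of a group `Γ` and of an endomorphism `σ` on a group `A`, such that `G` is the
group of fixed points of `σ`, the group `B` and the set `M` are the fixed points of `Γ`, and the
first cohomology of both actions vanishes. The group `B` acts on `M` by `σ`-conjugation. -/
structure LangDatum (Γ G A B M : Type*) [Group Γ] [TopologicalSpace Γ] [Group G]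
    [TopologicalSpace G] [Group A] [Group B] [MulAction B M] where
  i : G →* A
  j : B →* A
  e : M → A
  σ : A →* A
  act : Γ → A →* A
  i_injective : Function.Injective i
  j_injective : Function.Injective j
  e_injective : Function.Injective e
  act_mul : ∀ τ ρ a, act (τ * ρ) a = act τ (act ρ a)
  act_σ : ∀ τ a, act τ (σ a) = σ (act τ a)
  e_smul : ∀ b m, e (b • m) = σ (j b) * e m * (j b)⁻¹
  act_i : ∀ τ x, act τ (i x) = i x
  σ_i : ∀ x, σ (i x) = i x
  act_j : ∀ τ b, act τ (j b) = j b
  act_e : ∀ τ m, act τ (e m) = e m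
  exists_i : ∀ a, σ a = a → ∃ x, i x = a
  exists_j : ∀ a, (∀ τ, act τ a = a) → ∃ b, j b = a
  exists_e : ∀ a, (∀ τ, act τ a = a) → ∃ m, e m = a
  lang : ∀ a, ∃ g, σ g * g⁻¹ = a
  eventually_act : ∀ a, ∀ᶠ τ in 𝓝 1, act τ a = a
  exists_coboundary : ∀ γ : Γ →ₜ* G, ∃ g, ∀ τ, i (γ τ) = g⁻¹ * act τ g

namespace LangDatum

variable {Γ G A B M : Type*} [Group Γ] [TopologicalSpace Γ] [Group G]
    [TopologicalSpace G] [Group A] [Group B] [MulAction B M]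
    (D : LangDatum Γ G A B M)

/-- `γ` and `m` are the images of `g` under the two coboundary maps. -/
structure Rel (g : A) (γ : Γ →ₜ* G) (m : M) : Prop where
  lang : D.σ g * g⁻¹ = D.e m
  cob : ∀ τ, D.i (γ τ) = g⁻¹ * D.act τ g

variable {D} {g g' : A} {γ γ' : Γ →ₜ* G} {m m' : M}

theorem Rel.σ_eq (h : D.Rel g γ m) : D.σ g = D.e m * g := by
  rw [← h.lang, inv_mul_cancel_right]

theorem Rel.act_eq (h : D.Rel g γ m) (τ : Γ) : D.act τ g = g * D.i (γ τ) := by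
  rw [h.cob, mul_inv_cancel_left]

theorem Rel.of_eq (h1 : D.σ g = D.e m * g) (h2 : ∀ τ, D.act τ g = g * D.i (γ τ)) : D.Rel g γ m :=
  ⟨by rw [h1, mul_inv_cancel_right], fun τ => by rw [h2, inv_mul_cancel_left]⟩

/-- The factors `i (γ τ)` cancel in `τ(σ(g) g⁻¹)`, because `σ` fixes them, so `σ(g) g⁻¹` is Galois
invariant. -/
theorem exists_rel_of_coboundary (h : ∀ τ, D.i (γ τ) = g⁻¹ * D.act τ g) : ∃ m, D.Rel g γ m := by
  have h' : ∀ τ, D.act τ g = g * D.i (γ τ) := fun τ => by rw [h, mul_inv_cancel_left]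
  obtain ⟨m, hm⟩ := D.exists_e (D.σ g * g⁻¹) fun τ => by
    rw [map_mul, map_inv, D.act_σ, h', map_mul, D.σ_i]; group
  exact ⟨m, hm.symm, h⟩

theorem Rel.j_mul (h : D.Rel g γ m) (b : B) : D.Rel (D.j b * g) γ (b • m) := by
  refine .of_eq ?_ fun τ => ?_
  · rw [map_mul, h.σ_eq, D.e_smul]; group
  · rw [map_mul, D.act_j, h.act_eq, mul_assoc]

variable (D) in
theorem exists_rel_left (γ : Γ →ₜ* G) : ∃ m g, D.Rel g γ m := by
  obtain ⟨g, hg⟩ := D.exists_coboundary γ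
  obtain ⟨m, hm⟩ := exists_rel_of_coboundary hg
  exact ⟨m, g, hm⟩

/-- Both `g` and `g'` transform under `τ` by the same right factor, so `g' g⁻¹` is Galois invariant.
-/
theorem Rel.exists_smul_right (h : D.Rel g γ m) (h' : D.Rel g' γ m') :
    ∃ b, g' = D.j b * g ∧ m' = b • m := by
  obtain ⟨b, hb⟩ := D.exists_j (g' * g⁻¹) fun τ => by
    rw [map_mul, map_inv, h.act_eq, h'.act_eq]; group
  have hg : g' = D.j b * g := by rw [hb, inv_mul_cancel_right]
  refine ⟨b, hg, D.e_injective ?_⟩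
  rw [← (h.j_mul b).lang, ← hg, h'.lang]

variable [DiscreteTopology G]

theorem Rel.mul_i (h : D.Rel g γ m) (x : G) : D.Rel (g * (D.i x)⁻¹) (x • γ) m := by
  refine .of_eq ?_ fun τ => ?_
  · rw [map_mul, map_inv, D.σ_i, h.σ_eq, mul_assoc]
  · have hx : (x • γ) τ = x * γ τ * x⁻¹ := rfl
    rw [map_mul, map_inv, D.act_i, h.act_eq, hx, map_mul, map_mul, map_inv]
    group

/-- Here `σ` multiplies `g` and `g'` by the same left factor, so `g'⁻¹ g` is fixed by `σ`. -/
theorem Rel.exists_smul_left (h : D.Rel g γ m) (h' : D.Rel g' γ' m) :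
    ∃ x, g = g' * D.i x ∧ γ' = x • γ := by
  obtain ⟨x, hx⟩ := D.exists_i (g'⁻¹ * g) (by
    rw [map_mul, map_inv, h.σ_eq, h'.σ_eq]; group)
  have hg : g = g' * D.i x := by rw [hx, mul_inv_cancel_left]
  refine ⟨x, hg, ContinuousMonoidHom.ext fun τ => D.i_injective ?_⟩
  rw [(h.mul_i x).cob, hg, mul_inv_cancel_right, h'.cob]

theorem exists_rel_of_lang [IsTopologicalGroup Γ] (h : D.σ g * g⁻¹ = D.e m) :
    ∃ γ, D.Rel g γ m := by
  have h' : D.σ g = D.e m * g := by rw [← h, inv_mul_cancel_right]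
  have hex : ∀ τ, ∃ x, D.i x = g⁻¹ * D.act τ g := fun τ => D.exists_i _ (by
    rw [map_mul, map_inv, ← D.act_σ, h', map_mul, D.act_e]; group)
  choose c hc using hex
  let γ₀ : Γ →* G := MonoidHom.mk' c fun τ ρ => D.i_injective (by
    rw [map_mul, hc τ, ← D.act_i τ (c ρ), hc ρ, hc, D.act_mul, map_mul, map_inv]; group)
  -- Continuity need only be checked at the identity, near which `g` is fixed and the homomorphism
  -- is trivial.
  refine ⟨⟨γ₀, continuous_of_continuousAt_one γ₀ ?_⟩, h, hc⟩
  rw [ContinuousAt, map_one, nhds_discrete G, Filter.tendsto_pure]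
  filter_upwards [D.eventually_act g] with τ hτ
  exact D.i_injective (by rw [map_one]; exact (hc τ).trans (by rw [hτ, inv_mul_cancel]))

variable (D) in
/-- The bijection between conjugacy classes of homomorphisms and orbits. -/
def orb [IsTopologicalGroup Γ] : H1Trivial Γ G ≃ orbitRel.Quotient B M :=
  Equiv.ofBijective
    (Quotient.lift (fun γ => (Quotient.mk _ (D.exists_rel_left γ).choose : orbitRel.Quotient B M))
      (by
        rintro _ γ ⟨x, rfl⟩
        obtain ⟨g, h⟩ := (D.exists_rel_left γ).choose_spec
        obtain ⟨g', h'⟩ := (D.exists_rel_left (x • γ)).choose_spec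
        obtain ⟨b, -, hb⟩ := (h.mul_i x).exists_smul_right h'
        exact Quotient.sound ⟨b, hb.symm⟩))
    (by
      constructor
      · intro q q'
        induction q using Quotient.inductionOn with | _ γ
        induction q' using Quotient.inductionOn with | _ γ'
        intro hqq
        obtain ⟨b, hb⟩ := Quotient.exact hqq
        obtain ⟨g, h⟩ := (D.exists_rel_left γ).choose_spec
        obtain ⟨g', h'⟩ := (D.exists_rel_left γ').choose_spec
        obtain ⟨x, -, hx⟩ := (h'.j_mul b).exists_smul_left (hb ▸ h)
        exact Quotient.sound ⟨x, hx.symm⟩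
      · intro q
        induction q using Quotient.inductionOn with | _ m
        obtain ⟨g, hg⟩ := D.lang (D.e m)
        obtain ⟨γ, h⟩ := exists_rel_of_lang hg
        obtain ⟨g', h'⟩ := (D.exists_rel_left γ).choose_spec
        obtain ⟨b, -, hb⟩ := h.exists_smul_right h'
        exact ⟨Quotient.mk _ γ, Quotient.sound ⟨b, hb.symm⟩⟩)

theorem Rel.orb_eq [IsTopologicalGroup Γ] (h : D.Rel g γ m) :
    D.orb (h1Class γ) = Quotient.mk _ m := by
  obtain ⟨g', h'⟩ := (D.exists_rel_left γ).choose_spec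
  obtain ⟨b, -, hb⟩ := h.exists_smul_right h'
  exact Quotient.sound ⟨b, hb.symm⟩

theorem exists_rel_of_orb_eq [IsTopologicalGroup Γ]
    (h : D.orb (h1Class γ) = Quotient.mk _ m) : ∃ g, D.Rel g γ m := by
  obtain ⟨g', h'⟩ := (D.exists_rel_left γ).choose_spec
  obtain ⟨b, hb⟩ := Quotient.exact (h'.orb_eq.symm.trans h).symm
  exact ⟨D.j b * g', hb ▸ h'.j_mul b⟩

/-- Both sides consist of the elements `j b = g (i x) g⁻¹`: such an equality says that moving `g` by
`x` on the right or by `b` on the left gives the same link. -/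
theorem Rel.map_stabilizer_eq (h : D.Rel g γ m) :
    (stabilizer G γ).map ((MulAut.conj g).toMonoidHom.comp D.i) = (stabilizer B m).map D.j := by
  ext a
  constructor
  · rintro ⟨x, hx, rfl⟩
    have hx' : x⁻¹ • γ = γ := inv_mem (s := stabilizer G γ) hx
    obtain ⟨b, hb, hbm⟩ := h.exists_smul_right (hx' ▸ h.mul_i x⁻¹)
    refine ⟨b, hbm.symm, ?_⟩
    rw [map_inv, inv_inv] at hb
    simp [hb]
  · rintro ⟨b, hb, rfl⟩
    have hb' : b • m = m := hb
    obtain ⟨x, hx, hxγ⟩ := (hb' ▸ h.j_mul b : D.Rel (D.j b * g) γ m).exists_smul_left h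
    refine ⟨x, hxγ.symm, ?_⟩
    simp [← hx]

theorem Rel.nonempty_stabilizer_mulEquiv (h : D.Rel g γ m) :
    Nonempty (stabilizer G γ ≃* stabilizer B m) :=
  ⟨((stabilizer G γ).equivMapOfInjective _ ((MulAut.conj g).injective.comp D.i_injective)).trans
    ((MulEquiv.subgroupCongr h.map_stabilizer_eq).trans
      ((stabilizer B m).equivMapOfInjective _ D.j_injective).symm)⟩

end LangDatum

end Orbits

/-! ### The datum attached to a Lie algebra and a field -/

/-- Functoriality of the group `(L, ∘)`. -/
def BCHGroup.map {p : ℕ} [Fact p.Prime] {L L' : Type*} [LieRing L] [LieAlgebra ℤ_[p] L]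
    [LieRing L'] [LieAlgebra ℤ_[p] L'] (h : IsBCHGroupLaw p L) (h' : IsBCHGroupLaw p L')
    (f : L →ₗ⁅ℤ_[p]⁆ L') : BCHGroup h →* BCHGroup h' where
  toFun x := BCHGroup.mk h' (f x.val)
  map_one' := f.map_zero
  map_mul' x y := map_bch f x.val y.val

section Datum

variable {p : ℕ} [Fact p.Prime] {F Fsep : Type*} [Field F] [CharP F p] [Field Fsep] [CharP Fsep p]
  [Algebra F Fsep] [IsSepClosure F Fsep]
  {𝔤 : Type*} [LieRing 𝔤] [LieAlgebra ℤ_[p] 𝔤] [Finite 𝔤]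

/-- The maps between the groups `𝔤`, `𝔤 ⊗ W(F^perf)` and `𝔤 ⊗ W(F^alg)`. -/
def LieFiltration.langDatum (Φ : LieFiltration p 𝔤) (hG : IsBCHGroupLaw p 𝔤)
    (hF : IsBCHGroupLaw p (LieWitt p 𝔤 (PerfectClosure F p)))
    (hA : IsBCHGroupLaw p (LieWitt p 𝔤 (PerfectClosure Fsep p))) :
    LangDatum Gal(Fsep/F) (BCHGroup hG) (BCHGroup hA) (BCHGroup hF)
      (LieWitt p 𝔤 (PerfectClosure F p)) where
  i := BCHGroup.map hG hA (lieWittInclHom p 𝔤 _)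
  j := BCHGroup.map hF hA (perfToAlg p F Fsep 𝔤)
  e m := BCHGroup.mk hA (perfToAlg p F Fsep 𝔤 m)
  σ := BCHGroup.map hA hA (lieWittFrob p 𝔤 _)
  act τ := BCHGroup.map hA hA (galAct p 𝔤 τ)
  i_injective := Φ.lieWittIncl_injective _
  j_injective := Φ.lieWittMap_injective (RingHom.injective _)
  e_injective := Φ.lieWittMap_injective (RingHom.injective _)
  act_mul τ ρ a := (lieWittMap_comp (perfAct p τ) (perfAct p ρ) a.val).trans
    (congrArg (fun f => lieWittMap p 𝔤 f a.val) (RingHom.ext fun r => (perfAct_mul τ ρ r).symm)) |>.symm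
  act_σ τ a := (lieWittMap_comp (perfAct p τ) (frobenius _ p) a.val).trans
    ((congrArg (fun f => lieWittMap p 𝔤 f a.val) (RingHom.ext fun r => (perfAct p τ).map_pow r p)).trans
      (lieWittMap_comp (frobenius _ p) (perfAct p τ) a.val).symm)
  e_smul b m := by
    have h1 : perfToAlg p F Fsep 𝔤 (lieWittFrob p 𝔤 _ b.val) =
        lieWittFrob p 𝔤 _ (perfToAlg p F Fsep 𝔤 b.val) :=
      (lieWittMap_comp _ _ b.val).trans ((congrArg (fun f => lieWittMap p 𝔤 f b.val)
        (RingHom.ext fun r => (perfMap p (algebraMap F Fsep)).map_pow r p)).trans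
          (lieWittMap_comp _ _ b.val).symm)
    change perfToAlg p F Fsep 𝔤 (bch p (bch p (lieWittFrob p 𝔤 _ b.val) m) (-b.val)) =
      bch p (bch p (lieWittFrob p 𝔤 _ (perfToAlg p F Fsep 𝔤 b.val)) (perfToAlg p F Fsep 𝔤 m))
        (-perfToAlg p F Fsep 𝔤 b.val)
    rw [map_bch, map_bch, map_neg, h1]
  act_i τ x := lieWittMap_incl (perfAct p τ) x.val
  σ_i x := lieWittMap_incl (frobenius _ p) x.val
  act_j τ b := (lieWittMap_comp (perfAct p τ) _ b.val).trans
    (congrArg (fun f => lieWittMap p 𝔤 f b.val) (RingHom.ext (perfAct_perfMap τ)))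
  act_e τ m := (lieWittMap_comp (perfAct p τ) _ m).trans
    (congrArg (fun f => lieWittMap p 𝔤 f m) (RingHom.ext (perfAct_perfMap τ)))
  exists_i a ha := Φ.exists_lieWittIncl_eq (fun _ => exists_natCast_eq_of_pow_eq) a.val ha
  exists_j a ha := Φ.exists_lieWittMap_eq perfAct_perfMap exists_perfMap_eq a.val ha
  exists_e a ha := Φ.exists_lieWittMap_eq perfAct_perfMap exists_perfMap_eq a.val ha
  lang a := by
    have := IsSepClosure.sep_closed F (K := Fsep)
    exact Φ.artinSchreier_surjective
      (PerfectClosure.exists_pow_sub_eq IsSepClosed.exists_pow_sub_eq) a.val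
  eventually_act a := eventually_lieWittMap_eq eventually_perfAct_eq a.val
  exists_coboundary γ := by
    refine Φ.exists_eq_bch_neg perfAct_mul eventually_perfAct_eq exists_eq_perfAct_sub
      (fun τ => (γ τ).val) (fun τ ρ => congrArg BCHGroup.val (map_mul γ τ ρ)) ?_
    have h := γ.continuous_toFun.continuousAt (x := 1)
    rw [ContinuousAt, nhds_discrete (BCHGroup hG), Filter.tendsto_pure] at h
    exact h.mono fun τ hτ => congrArg BCHGroup.val (hτ.trans (map_one γ))

end Datum

end

theorem mainTheorem7 (p : ℕ) [Fact p.Prime]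
    (F Fsep : Type*) [Field F] [CharP F p] [Field Fsep] [CharP Fsep p]
    [Algebra F Fsep] [IsSepClosure F Fsep]
    (𝔤 : Type*) [LieRing 𝔤] [LieAlgebra ℤ_[p] 𝔤] [Finite 𝔤]
    [LieRing.IsNilpotent 𝔤] (hclass : LieModule.nilpotencyLength 𝔤 𝔤 < p) :
    -- the operation `∘` is a group law on `𝔤`, on `𝔤 ⊗ W(F^perf)` and on `𝔤 ⊗ W(F^alg)`
    ∃ (hG : IsBCHGroupLaw p 𝔤)
      (hF : IsBCHGroupLaw p (LieWitt p 𝔤 (PerfectClosure F p)))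
      (_ : IsBCHGroupLaw p (LieWitt p 𝔤 (PerfectClosure Fsep p)))
      -- the bijection
      (orb : H1Trivial Gal(Fsep/F) (BCHGroup hG) ≃ FrobOrbits hF),
      -- if `℘(g)` lies in `𝔤 ⊗ W(F^perf)`, then `τ ↦ (-g) ∘ τ(g)` is a continuous
      -- homomorphism from `Γ_F` to `(𝔤, ∘)`
      (∀ (g : LieWitt p 𝔤 (PerfectClosure Fsep p)) (m : LieWitt p 𝔤 (PerfectClosure F p)),
        artinSchreier p 𝔤 (PerfectClosure Fsep p) g = perfToAlg p F Fsep 𝔤 m →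
          ∃ γ : Gal(Fsep/F) →ₜ* BCHGroup hG, IsGivenBy γ g) ∧
      -- every continuous homomorphism is of that form
      (∀ γ : Gal(Fsep/F) →ₜ* BCHGroup hG,
        ∃ (g : LieWitt p 𝔤 (PerfectClosure Fsep p)) (m : LieWitt p 𝔤 (PerfectClosure F p)),
          artinSchreier p 𝔤 (PerfectClosure Fsep p) g = perfToAlg p F Fsep 𝔤 m ∧
            IsGivenBy γ g) ∧
      -- the bijection maps the class of `τ ↦ (-g) ∘ τ(g)` to the orbit of `℘(g)`
      (∀ (g : LieWitt p 𝔤 (PerfectClosure Fsep p)) (m : LieWitt p 𝔤 (PerfectClosure F p))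
        (γ : Gal(Fsep/F) →ₜ* BCHGroup hG),
        artinSchreier p 𝔤 (PerfectClosure Fsep p) g = perfToAlg p F Fsep 𝔤 m →
          IsGivenBy γ g → orb (h1Class γ) = frobOrbit hF m) ∧
      -- corresponding stabilizers are isomorphic
      (∀ (γ : Gal(Fsep/F) →ₜ* BCHGroup hG) (m : LieWitt p 𝔤 (PerfectClosure F p)),
        orb (h1Class γ) = frobOrbit hF m →
          Nonempty (MulAction.stabilizer (BCHGroup hG) γ ≃*
            MulAction.stabilizer (BCHGroup hF) m)) := by
  let Φ : LieFiltration p 𝔤 := .ofNilpotencyLength hclass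
  let hG := Φ.isBCHGroupLaw
  let hF := Φ.isBCHGroupLaw_lieWitt (PerfectClosure F p)
  let hA := Φ.isBCHGroupLaw_lieWitt (PerfectClosure Fsep p)
  let D : LangDatum Gal(Fsep/F) _ _ _ _ := Φ.langDatum hG hF hA
  refine ⟨hG, hF, hA, D.orb, fun g m hgm => ?_, fun γ => ?_, fun g m γ hgm hγ => ?_,
    fun γ m h => ?_⟩
  -- The hypothesis on `℘(g)` is definitionally the `lang` condition of `LangDatum.Rel`, and
  -- `IsGivenBy` is its `cob` condition.
  · obtain ⟨γ, hγ⟩ := LangDatum.exists_rel_of_lang (D := D) (g := BCHGroup.mk hA g) (m := m) hgm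
    exact ⟨γ, hγ.cob⟩
  · obtain ⟨m, g, h⟩ := D.exists_rel_left γ
    exact ⟨g.val, m, h.lang, h.cob⟩
  · exact LangDatum.Rel.orb_eq (D := D) (g := BCHGroup.mk hA g) ⟨hgm, hγ⟩
  · obtain ⟨g, hg⟩ := LangDatum.exists_rel_of_orb_eq h
    exact hg.nonempty_stabilizer_mulEquiv
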